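/- Let $n\in\mathbb{N}$, let $\phi$ be a real-valued Schwartz function on $\mathbb{R}^n$ with $\int_{\mathbb{R}^n}\phi(x)\,dx=1$, and put $\phi_t(x):=t^{-n}\phi(x/t)$ and $\Phi_t f:=\phi_t * f$ for $t>0$. Let $1<p<\infty$, $\delta>1$ and $M\ge 0$. Then there is a constant $C>0$, depending only on $n$, $p$, $M$, $\delta$ and $\phi$, with the following property. For every sequence $a=\{a_i\}_{i\in\mathbb{Z}}$ of positive numbers that is $\delta$-lacunary, i.e. $a_{i+1}/a_i\ge\delta$ for all $i\in\mathbb{Z}$, every sequence $v=\{v_i\}_{i\in\mathbb{Z}}$ of complex numbers with $\|v\|_{\ell^\infty(\mathbb{Z})}\le M$, and every complex-valued $f\in L^p(\mathbb{R}^n)$, the maximal differential transform $$\mathcal{S}_{a,v;*}(\{\Phi_t\}_{t>0},f)(x):=\sup_{N_1,N_2\in\mathbb{Z},\ N_1<N_2}\left|\sum_{i=N_1}^{N_2}v_i\bigl(\Phi_{a_{i+1}}f(x)-\Phi_{a_i}f(x)\bigr)\right|\in[0,\infty]$$ is measurable and satisfies $$\left\|\mathcal{S}_{a,v;*}(\{\Phi_t\}_{t>0},f)\right\|_{L^p(\mathbb{R}^n)}\le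 C\,\|f\|_{L^p(\mathbb{R}^n)}.$$ (For such $f$ the integrals defining $\phi_t*f(x)$ converge absolutely for all $t>0$ and $x\in\mathbb{R}^n$.) -/

import Mathlib

open MeasureTheory
open scoped ENNReal NNReal SchwartzMap

noncomputable section

/-- A two-sided sequence `a` of positive numbers with `a (i + 1) / a i ≥ δ` for all `i : ℤ`. -/
structure IsLacunary (δ : ℝ) (a : ℤ → ℝ) : Prop where
  pos : ∀ i, 0 < a i
  ratio : ∀ i, δ ≤ a (i + 1) / a i

/-- The dilate `φ_t(x) = t⁻ⁿ φ(x / t)`. -/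
def dilate {n : ℕ} (φ : EuclideanSpace ℝ (Fin n) → ℝ) (t : ℝ)
    (x : EuclideanSpace ℝ (Fin n)) : ℝ :=
  (t ^ n)⁻¹ * φ (t⁻¹ • x)

/-- The convolution operator `Φ_t f = φ_t * f` on `ℝⁿ` with Lebesgue measure. -/
def approxId {n : ℕ} (φ : EuclideanSpace ℝ (Fin n) → ℝ) (t : ℝ)
    (f : EuclideanSpace ℝ (Fin n) → ℂ) : EuclideanSpace ℝ (Fin n) → ℂ :=
  convolution (dilate φ t) f (ContinuousLinearMap.lsmul ℝ ℝ) volume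

/-- The partial sum `∑_{i = N₁}^{N₂} v_i (T_{a_{i+1}} f(x) - T_{a_i} f(x))` of the differential
transform of a family of operators `T`. -/
def diffTransform {X : Type*} (T : ℝ → (X → ℂ) → X → ℂ) (a : ℤ → ℝ) (v : ℤ → ℂ)
    (N₁ N₂ : ℤ) (f : X → ℂ) (x : X) : ℂ :=
  ∑ i ∈ Finset.Icc N₁ N₂, v i * (T (a (i + 1)) f x - T (a i) f x)

/-- The maximal differential transform: the supremum, in `[0, ∞]`, of the moduli of the partial
sums over all pairs of integers `N₁ < N₂`. -/
def maximalDiffTransform {X : Type*} (T : ℝ → (X → ℂ) → X → ℂ) (a : ℤ → ℝ) (v : ℤ → ℂ)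
    (f : X → ℂ) (x : X) : ℝ≥0∞ :=
  ⨆ (N₁ : ℤ) (N₂ : ℤ) (_ : N₁ < N₂), ‖diffTransform T a v N₁ N₂ f x‖ₑ

end

/-! ### The Hardy–Littlewood maximal function -/

section MaximalFunction

open Metric Set Module

variable {E : Type*} [NormedAddCommGroup E] [InnerProductSpace ℝ E] [FiniteDimensional ℝ E]
  [MeasurableSpace E] [BorelSpace E]

/-! For fixed `N₁`, `N₂` the partial sum is convolution of `f` with `diffKernel`. The point is that
these kernels are Calderón–Zygmund with a constant `A` depending only on `φ`, `δ`, `M` and `n`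
(`exists_isCZKernel_diffKernel`). No cancellation in `v` is available, so everything rests on
absolute sums over scales. A Schwartz profile at scale `a i`, seen at radius `R`, contributes at
most a multiple of `min (a i / R) (R / a i)`, and by lacunarity these sum to at most `2δ/(δ-1)`
(`IsLacunary.sum_min_le`). On the Fourier side this bounds the multiplier, hence the `L²` norm by
Plancherel; on the space side it gives the Lipschitz smoothness condition.

Uniform `L^q` bounds follow in `exists_convOp_lp`. For `q > 2` a good-`λ` inequality compares the
maximal function of `K * f` with `M(|f|²)^{1/2}`; `q < 2` is dual to this, and `q = 2` is the `L²`
hypothesis. The constant in the pointwise bound of a single kernel by the Poisson majorant is not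
uniform; it is used only for convergence and finiteness and never enters the final constants.

The supremum is handled by Cotlar's inequality (`exists_cotlar`). Apply `Φ_{a_N}` to the sum over
`[L₁, L₂]`: scales above `a_N` are almost unchanged, while scales below it are almost all replaced
by the single function `Φ_{a_N} f`, so that their differences nearly vanish. The errors decay
geometrically away from `N` (`exists_almost_orthogonality`). Hence the sum over `[N, L₂]` is
dominated by the maximal functions of the full sum and of `f`. Any sum over `[N₁, N₂]` is a
difference of two such sums with common upper end `L`. Fatou's lemma along the symmetric ranges
`[-L, L]` together with the maximal theorem finishes the proof. -/

/-- The uncentred Hardy–Littlewood maximal function of a function with values in `[0, ∞]`. -/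
noncomputable def maximalFn (g : E → ℝ≥0∞) (x : E) : ℝ≥0∞ :=
  ⨆ (c : E) (r : ℝ) (_ : x ∈ ball c r), (∫⁻ y in ball c r, g y) / volume (ball c r)

theorem volume_ball_ne_top (c : E) (r : ℝ) : volume (ball c r) ≠ ∞ := measure_ball_lt_top.ne

theorem volume_ball_ne_zero (c : E) {r : ℝ} (hr : 0 < r) : volume (ball c r) ≠ 0 :=
  (measure_ball_pos volume c hr).ne'

theorem lintegral_ball_le_maximalFn (g : E → ℝ≥0∞) {x c : E} {r : ℝ} (hx : x ∈ ball c r) :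
    ∫⁻ y in ball c r, g y ≤ volume (ball c r) * maximalFn g x := by
  have hr : 0 < r := pos_of_mem_ball hx
  have h : (∫⁻ y in ball c r, g y) / volume (ball c r) ≤ maximalFn g x :=
    le_iSup_of_le c (le_iSup_of_le r (le_iSup_of_le hx le_rfl))
  rw [mul_comm]
  exact (ENNReal.div_le_iff (volume_ball_ne_zero c hr) (volume_ball_ne_top c r)).1 h

theorem lt_maximalFn_iff {g : E → ℝ≥0∞} {x : E} {a : ℝ≥0∞} :
    a < maximalFn g x ↔
      ∃ c r, x ∈ ball c r ∧ a * volume (ball c r) < ∫⁻ y in ball c r, g y := by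
  simp only [maximalFn, lt_iSup_iff, exists_prop]
  refine exists_congr fun c => exists_congr fun r => and_congr_right fun hx => ?_
  have hr : 0 < r := pos_of_mem_ball hx
  exact ENNReal.lt_div_iff_mul_lt (.inl (volume_ball_ne_zero c hr)) (.inl (volume_ball_ne_top c r))

theorem maximalFn_le_iff {g : E → ℝ≥0∞} {x : E} {a : ℝ≥0∞} :
    maximalFn g x ≤ a ↔
      ∀ c r, x ∈ ball c r → ∫⁻ y in ball c r, g y ≤ a * volume (ball c r) := by
  rw [← not_lt, lt_maximalFn_iff]; push Not; rfl

/-- Balls need not be centred at `x`, so a ball witnessing `a < maximalFn g x` witnesses it at all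
of its points. Measurability of `maximalFn g` thus requires none of `g`. -/
theorem isOpen_lt_maximalFn (g : E → ℝ≥0∞) (a : ℝ≥0∞) : IsOpen {x | a < maximalFn g x} := by
  have : {x | a < maximalFn g x} = ⋃ (c : E) (r : ℝ)
      (_ : a * volume (ball c r) < ∫⁻ y in ball c r, g y), ball c r := by
    ext x
    simp only [mem_ofPred_eq, lt_maximalFn_iff, mem_iUnion, exists_prop, and_comm]
  rw [this]
  exact isOpen_iUnion fun c => isOpen_iUnion fun r => isOpen_iUnion fun _ => isOpen_ball

theorem measurable_maximalFn (g : E → ℝ≥0∞) : Measurable (maximalFn g) :=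
  measurable_of_Ioi fun a => (isOpen_lt_maximalFn g a).measurableSet

theorem maximalFn_mono {g h : E → ℝ≥0∞} (hgh : ∀ x, g x ≤ h x) (x : E) :
    maximalFn g x ≤ maximalFn h x := by
  refine iSup_mono fun c => iSup_mono fun r => iSup_mono fun _ => ?_
  gcongr with y
  exact hgh y

theorem maximalFn_add_const_le (g : E → ℝ≥0∞) (a : ℝ≥0∞) (x : E) :
    maximalFn (fun y => g y + a) x ≤ maximalFn g x + a := by
  refine maximalFn_le_iff.2 fun c r hx => ?_
  rw [lintegral_add_right _ measurable_const, setLIntegral_const, add_mul]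
  gcongr
  rw [mul_comm]
  exact lintegral_ball_le_maximalFn g hx

theorem volume_ball_mul [Nontrivial E] (c c' : E) {r : ℝ} (hr : 0 ≤ r) (k : ℝ≥0) :
    volume (ball c (k * r)) = (k : ℝ≥0∞) ^ finrank ℝ E * volume (ball c' r) := by
  rw [Measure.addHaar_ball _ _ hr, Measure.addHaar_ball _ _ (by positivity), mul_pow,
    ENNReal.ofReal_mul (by positivity), mul_assoc, ENNReal.ofReal_pow (by positivity),
    ENNReal.ofReal_coe_nnreal]

/-- The Vitali covering lemma needs bounded radii. A volume bound supplies them, because `r ≤ r ^ d`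
for `r > 1` and `d ≥ 1`. -/
theorem exists_radius_bound [Nontrivial E] {S : ℝ≥0∞} (hS : S ≠ ∞) :
    ∃ R : ℝ, ∀ (c : E) (r : ℝ), volume (ball c r) ≤ S → r ≤ R := by
  have h0 : volume (ball (0 : E) 1) ≠ 0 := volume_ball_ne_zero 0 one_pos
  set q := (S / volume (ball (0 : E) 1)).toReal with hq
  have hqt : S / volume (ball (0 : E) 1) ≠ ∞ := (ENNReal.div_lt_top hS h0).ne
  refine ⟨max 1 q, fun c r h => ?_⟩
  by_contra! hr
  have hr1 : 1 < r := (le_max_left _ _).trans_lt hr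
  have hrq : q < r := (le_max_right _ _).trans_lt hr
  rw [Measure.addHaar_ball _ _ (by linarith),
    ← ENNReal.le_div_iff_mul_le (.inl h0) (.inl (volume_ball_ne_top _ _)),
    ← ENNReal.ofReal_toReal hqt, ← hq, ENNReal.ofReal_le_ofReal_iff (by positivity)] at h
  have : r ≤ r ^ finrank ℝ E := le_self_pow₀ hr1.le finrank_pos.ne'
  linarith

/-- A Vitali covering argument: a set `s` covered by balls on whose fivefold dilates `s` has
measure controlled by `ν` has total measure controlled by `ν`. -/
theorem volume_le_of_vitali (ν : Measure E) (s : Set E) (c : E → E) (r : E → ℝ) (R : ℝ)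
    (hR : ∀ x ∈ s, r x ≤ R) (hc : ∀ x ∈ s, x ∈ ball (c x) (r x))
    (h : ∀ x ∈ s, volume (s ∩ ball (c x) (5 * r x)) ≤ ν (ball (c x) (r x))) :
    volume s ≤ ν univ := by
  obtain ⟨u, hus, hdisj, hcov⟩ :=
    Vitali.exists_disjoint_subfamily_covering_enlargement_ball s c r R hR 5 (by norm_num)
  have hu : u.Countable := hdisj.countable_of_isOpen (fun _ _ => isOpen_ball)
    fun x hx => ⟨x, hc x (hus hx)⟩
  have hsub : s ⊆ ⋃ b ∈ u, s ∩ ball (c b) (5 * r b) := fun x hx => by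
    obtain ⟨b, hb, hxb⟩ := hcov x hx
    exact mem_biUnion hb ⟨hx, hxb (hc x hx)⟩
  calc volume s ≤ volume (⋃ b ∈ u, s ∩ ball (c b) (5 * r b)) := measure_mono hsub
    _ ≤ ∑' b : u, volume (s ∩ ball (c b) (5 * r b)) := measure_biUnion_le _ hu _
    _ ≤ ∑' b : u, ν (ball (c b) (r b)) := ENNReal.tsum_le_tsum fun b => h b (hus b.2)
    _ = ν (⋃ b ∈ u, ball (c b) (r b)) :=
      (measure_biUnion hu hdisj fun _ _ => measurableSet_ball).symm
    _ ≤ ν univ := measure_mono (subset_univ _)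

theorem weak_type_maximalFn [Nontrivial E] (g : E → ℝ≥0∞) (a : ℝ≥0∞) :
    a * volume {x | a < maximalFn g x} ≤ 5 ^ finrank ℝ E * ∫⁻ y, g y := by
  rcases eq_or_ne a ∞ with rfl | hat
  · simp
  rcases eq_or_ne a 0 with rfl | ha0
  · simp
  rcases eq_or_ne (∫⁻ y, g y) ∞ with hg | hg
  · simp [hg]
  have hsel : ∀ x, ∃ (c : E) (r : ℝ), a < maximalFn g x →
      x ∈ ball c r ∧ a * volume (ball c r) < ∫⁻ y in ball c r, g y := fun x => by
    by_cases hx : a < maximalFn g x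
    · obtain ⟨c, r, h⟩ := lt_maximalFn_iff.1 hx
      exact ⟨c, r, fun _ => h⟩
    · exact ⟨0, 0, fun h => absurd h hx⟩
  choose c r hcr using hsel
  obtain ⟨R, hR⟩ := exists_radius_bound (E := E) (S := (∫⁻ y, g y) / a)
    (ENNReal.div_lt_top hg ha0).ne
  rw [mul_comm, ← ENNReal.le_div_iff_mul_le (.inl ha0) (.inl hat)]
  -- The selected balls satisfy `a |B| < ∫_B g`, so `ν = (5^d / a) g dx` dominates the volume of the
  -- fivefold dilate.
  have key := volume_le_of_vitali
    (((5 : ℝ≥0∞) ^ finrank ℝ E / a) • volume.withDensity g) {x | a < maximalFn g x} c r R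
    (fun x hx => hR (c x) (r x) ?_) (fun x hx => (hcr x hx).1) fun x hx => ?_
  · refine key.trans_eq ?_
    simp [withDensity_apply _ MeasurableSet.univ, ENNReal.div_eq_inv_mul, mul_assoc]
  · rw [ENNReal.le_div_iff_mul_le (.inl ha0) (.inl hat), mul_comm]
    exact (hcr x hx).2.le.trans (setLIntegral_le_lintegral _ _)
  · obtain ⟨h1, h2⟩ := hcr x hx
    have hr : 0 < r x := pos_of_mem_ball h1
    refine (measure_mono inter_subset_right).trans ?_
    rw [Measure.smul_apply, withDensity_apply _ measurableSet_ball, smul_eq_mul,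
      ENNReal.mul_div_right_comm.symm, ENNReal.le_div_iff_mul_le (.inl ha0) (.inl hat)]
    have := volume_ball_mul (c x) (c x) hr.le 5
    norm_num at this
    rw [this, mul_assoc]
    gcongr
    rw [mul_comm]
    exact h2.le

/-- The case `u = ∞` is included so that the layer cake formula applies to maximal functions before
they are known to be finite. It follows by comparison with finite levels `v` for which `v ^ q / q`
is any prescribed `w`. -/
theorem lintegral_Ioi_rpow_of_lt {q : ℝ} (hq : 0 < q) (u : ℝ≥0∞) :
    ∫⁻ t in Ioi (0 : ℝ), {t : ℝ | ENNReal.ofReal t < u}.indicator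
      (fun t => ENNReal.ofReal (t ^ (q - 1))) t = u ^ q / ENNReal.ofReal q := by
  have fin : ∀ v : ℝ≥0, ∫⁻ t in Ioi (0 : ℝ), {t : ℝ | ENNReal.ofReal t < v}.indicator
      (fun t => ENNReal.ofReal (t ^ (q - 1))) t = (v : ℝ≥0∞) ^ q / ENNReal.ofReal q := by
    intro v
    have hset : {t : ℝ | ENNReal.ofReal t < v} ∩ Ioi 0 = Ioo 0 (v : ℝ) := by
      ext t
      simp only [mem_inter_iff, mem_ofPred_eq, mem_Ioi, mem_Ioo]
      constructor
      · rintro ⟨h1, h2⟩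
        refine ⟨h2, ?_⟩
        rwa [← ENNReal.ofReal_coe_nnreal, ENNReal.ofReal_lt_ofReal_iff_of_nonneg h2.le] at h1
      · rintro ⟨h1, h2⟩
        refine ⟨?_, h1⟩
        rwa [← ENNReal.ofReal_coe_nnreal, ENNReal.ofReal_lt_ofReal_iff_of_nonneg h1.le]
    have hm : MeasurableSet {t : ℝ | ENNReal.ofReal t < v} :=
      measurableSet_lt ENNReal.measurable_ofReal measurable_const
    rw [lintegral_indicator hm, Measure.restrict_restrict hm, hset,
      ← setLIntegral_congr (Ioo_ae_eq_Ioc (μ := volume) (a := (0 : ℝ)) (b := (v : ℝ))).symm,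
      ← ofReal_integral_eq_lintegral_ofReal]
    · rw [show ∫ t in Ioc (0 : ℝ) v, t ^ (q - 1) = ∫ t in (0 : ℝ)..v, t ^ (q - 1) from
        (intervalIntegral.integral_of_le v.2).symm, integral_rpow (.inl (by linarith))]
      rw [sub_add_cancel, Real.zero_rpow hq.ne', sub_zero, ENNReal.ofReal_div_of_pos hq,
        ← NNReal.coe_rpow, ENNReal.ofReal_coe_nnreal, ENNReal.coe_rpow_of_nonneg _ hq.le]
    · exact (intervalIntegral.intervalIntegrable_rpow' (by linarith)).1
    · exact (ae_restrict_iff' measurableSet_Ioc).2 (.of_forall fun t ht =>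
        Real.rpow_nonneg ht.1.le _)
  induction u with
  | coe v => exact fin v
  | top =>
    rw [ENNReal.top_rpow_of_pos hq, ENNReal.top_div_of_ne_top ENNReal.ofReal_ne_top]
    refine ENNReal.eq_top_of_forall_nnreal_le fun w => ?_
    have h1 : (0 : ℝ) ≤ w * q := by positivity
    set v : ℝ≥0 := ⟨(w * q) ^ (1 / q), Real.rpow_nonneg h1 _⟩ with hv
    have hvq : (v : ℝ≥0∞) ^ q / ENNReal.ofReal q = w := by
      have : (v : ℝ≥0∞) = ENNReal.ofReal ((w * q) ^ (1 / q)) := by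
        rw [← ENNReal.ofReal_coe_nnreal]; rfl
      rw [this, ENNReal.ofReal_rpow_of_nonneg (Real.rpow_nonneg h1 _) hq.le, ← Real.rpow_mul h1,
        one_div, inv_mul_cancel₀ hq.ne', Real.rpow_one, ← ENNReal.ofReal_div_of_pos hq,
        mul_div_cancel_right₀ _ hq.ne', ENNReal.ofReal_coe_nnreal]
    rw [← hvq, ← fin v]
    refine lintegral_mono fun t => indicator_le_indicator_of_subset ?_ (fun _ => zero_le) t
    exact fun t ht => (lt_top_iff_ne_top.2 ENNReal.ofReal_ne_top)

/-- The layer cake formula for functions with values in `[0, ∞]`. -/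
theorem lintegral_rpow_layercake {X : Type*} [MeasurableSpace X] (μ : Measure X) [SFinite μ]
    {q : ℝ} (hq : 0 < q) {u h : X → ℝ≥0∞} (hu : AEMeasurable u μ) (hh : AEMeasurable h μ) :
    ∫⁻ t in Ioi (0 : ℝ), ENNReal.ofReal (t ^ (q - 1)) *
        ∫⁻ x, {x | ENNReal.ofReal t < u x}.indicator h x ∂μ =
      (∫⁻ x, h x * u x ^ q ∂μ) / ENNReal.ofReal q := by
  -- Tonelli needs the region `t < u x` to be jointly measurable, so `u` and `h` are replaced by
  -- measurable representatives.
  wlog hm : Measurable u ∧ Measurable h generalizing u h with H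
  · have := H hu.measurable_mk.aemeasurable hh.measurable_mk.aemeasurable
      ⟨hu.measurable_mk, hh.measurable_mk⟩
    have e1 : ∫⁻ x, h x * u x ^ q ∂μ = ∫⁻ x, hh.mk h x * hu.mk u x ^ q ∂μ := by
      refine lintegral_congr_ae ?_
      filter_upwards [hu.ae_eq_mk, hh.ae_eq_mk] with x h1 h2
      rw [← h1, ← h2]
    rw [e1, ← this]
    refine lintegral_congr fun t => ?_
    congr 1
    refine lintegral_congr_ae ?_
    filter_upwards [hu.ae_eq_mk, hh.ae_eq_mk] with x h1 h2
    by_cases hx : ENNReal.ofReal t < u x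
    · have hx' : ENNReal.ofReal t < hu.mk u x := h1 ▸ hx
      simp [hx, hx', h2]
    · have hx' : ¬ ENNReal.ofReal t < hu.mk u x := h1 ▸ hx
      simp [hx, hx']
  obtain ⟨hu, hh⟩ := hm
  have hS : MeasurableSet {z : ℝ × X | ENNReal.ofReal z.1 < u z.2} :=
    measurableSet_lt (ENNReal.measurable_ofReal.comp measurable_fst) (hu.comp measurable_snd)
  have hF : Measurable (fun z : ℝ × X => {z : ℝ × X | ENNReal.ofReal z.1 < u z.2}.indicator
      (fun z => ENNReal.ofReal (z.1 ^ (q - 1)) * h z.2) z) := by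
    refine Measurable.indicator ?_ hS
    fun_prop
  calc
    _ = ∫⁻ t in Ioi (0 : ℝ), ∫⁻ x, {z : ℝ × X | ENNReal.ofReal z.1 < u z.2}.indicator
      (fun z => ENNReal.ofReal (z.1 ^ (q - 1)) * h z.2) (t, x) ∂μ := by
        refine lintegral_congr fun t => ?_
        rw [← lintegral_const_mul]
        · refine lintegral_congr fun x => ?_
          by_cases hx : ENNReal.ofReal t < u x <;> simp [indicator, hx]
        · exact hh.indicator (measurableSet_lt measurable_const hu)
    _ = ∫⁻ x, (∫⁻ t in Ioi (0 : ℝ), {z : ℝ × X | ENNReal.ofReal z.1 < u z.2}.indicator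
      (fun z => ENNReal.ofReal (z.1 ^ (q - 1)) * h z.2) (t, x)) ∂μ :=
        lintegral_lintegral_swap hF.aemeasurable
    _ = ∫⁻ x, h x * (u x ^ q / ENNReal.ofReal q) ∂μ := by
        refine lintegral_congr fun x => ?_
        rw [← lintegral_Ioi_rpow_of_lt hq, ← lintegral_const_mul]
        · refine lintegral_congr fun t => ?_
          by_cases hx : ENNReal.ofReal t < u x <;> simp [indicator, hx, mul_comm]
        · refine Measurable.indicator (by fun_prop) ?_
          exact measurableSet_lt ENNReal.measurable_ofReal measurable_const
    _ = _ := by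
        simp only [div_eq_mul_inv, ← mul_assoc]
        rw [lintegral_mul_const _ (by fun_prop)]

theorem lintegral_rpow_eq_layercake {X : Type*} [MeasurableSpace X] (μ : Measure X) [SFinite μ]
    {q : ℝ} (hq : 0 < q) {u : X → ℝ≥0∞} (hu : Measurable u) :
    ∫⁻ x, u x ^ q ∂μ = ENNReal.ofReal q * ∫⁻ t in Ioi (0 : ℝ), ENNReal.ofReal (t ^ (q - 1)) *
        μ {x | ENNReal.ofReal t < u x} := by
  have h := lintegral_rpow_layercake μ hq hu.aemeasurable (h := fun _ => 1) aemeasurable_const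
  have h0 : ENNReal.ofReal q ≠ 0 := by simpa using hq
  simp only [one_mul] at h
  rw [ENNReal.eq_div_iff h0 ENNReal.ofReal_ne_top] at h
  rw [← h]
  congr 1
  refine lintegral_congr fun t => ?_
  rw [show (fun _ : X => (1 : ℝ≥0∞)) = 1 from rfl,
    lintegral_indicator_one (measurableSet_lt measurable_const hu)]

/-- The Hardy–Littlewood maximal theorem. -/
theorem strong_type_maximalFn (E : Type*) [NormedAddCommGroup E] [InnerProductSpace ℝ E]
    [FiniteDimensional ℝ E] [MeasurableSpace E] [BorelSpace E] [Nontrivial E]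
    {q : ℝ} (hq : 1 < q) :
    ∃ C : ℝ≥0, ∀ g : E → ℝ≥0∞, AEMeasurable g volume →
      ∫⁻ x, maximalFn g x ^ q ≤ C * ∫⁻ x, g x ^ q := by
  have hq0 : 0 < q := by linarith
  have hq1 : 0 < q - 1 := by linarith
  -- The factor `2 * 5 ^ d` is the weak-type bound at height `t / 2`, `2 ^ (q - 1)` comes from
  -- truncating at `2 * g`, and `q` and `1 / (q - 1)` from two layer cake formulas.
  set D : ℝ≥0∞ := ENNReal.ofReal q * (2 * 5 ^ finrank ℝ E) * 2 ^ (q - 1) /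
    ENNReal.ofReal (q - 1) with hD
  have hDt : D ≠ ∞ := by
    refine (ENNReal.div_lt_top (ENNReal.mul_ne_top (ENNReal.mul_ne_top ENNReal.ofReal_ne_top
      (ENNReal.mul_ne_top (by simp) (by simp))) (by simp)) (by simpa using hq)).ne
  refine ⟨D.toNNReal, fun g hg => ?_⟩
  rw [ENNReal.coe_toNNReal hDt, lintegral_rpow_eq_layercake _ hq0 (measurable_maximalFn g)]
  have hpt : ∀ t ∈ Ioi (0 : ℝ), ENNReal.ofReal (t ^ (q - 1)) *
      volume {x | ENNReal.ofReal t < maximalFn g x} ≤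
      (2 * 5 ^ finrank ℝ E) * (ENNReal.ofReal (t ^ (q - 1 - 1)) *
        ∫⁻ x, {x | ENNReal.ofReal t < 2 * g x}.indicator g x) := by
    intro t ht
    have ht : 0 < t := ht
    -- Marcinkiewicz truncation: the part of `g` at most `t / 2` adds at most `t / 2` to the maximal
    -- function, so only `G` matters at level `t`.
    set G := {x | ENNReal.ofReal t < 2 * g x}.indicator g with hG
    have hgG : ∀ x, g x ≤ G x + ENNReal.ofReal (t / 2) := fun x => by
      by_cases hx : ENNReal.ofReal t < 2 * g x
      · simp [hG, hx]
      · refine le_add_left ?_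
        rw [ENNReal.ofReal_div_of_pos two_pos, ENNReal.le_div_iff_mul_le (by simp) (by simp)]
        simpa [mul_comm] using hx
    have hsub : {x | ENNReal.ofReal t < maximalFn g x} ⊆
        {x | ENNReal.ofReal (t / 2) < maximalFn G x} := fun x hx => by
      have h1 : ENNReal.ofReal t < maximalFn G x + ENNReal.ofReal (t / 2) :=
        (lt_of_lt_of_le hx (maximalFn_mono hgG x)).trans_le (maximalFn_add_const_le G _ x)
      by_contra hcon
      have h2 : maximalFn G x ≤ ENNReal.ofReal (t / 2) := by simpa using hcon
      have := h1.trans_le (add_le_add_left h2 _)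
      rw [← ENNReal.ofReal_add (by positivity) (by positivity), add_halves] at this
      exact lt_irrefl _ this
    have hw := weak_type_maximalFn G (ENNReal.ofReal (t / 2))
    have e1 : ENNReal.ofReal (t ^ (q - 1)) =
        2 * ENNReal.ofReal (t ^ (q - 1 - 1)) * ENNReal.ofReal (t / 2) := by
      rw [show (2 : ℝ≥0∞) = ENNReal.ofReal 2 by simp, ← ENNReal.ofReal_mul (by positivity),
        ← ENNReal.ofReal_mul (by positivity), Real.rpow_sub_one ht.ne' (q - 1)]
      congr 1
      generalize t ^ (q - 1) = z
      field_simp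
    calc _ ≤ ENNReal.ofReal (t ^ (q - 1)) *
          volume {x | ENNReal.ofReal (t / 2) < maximalFn G x} := by gcongr
      _ = 2 * ENNReal.ofReal (t ^ (q - 1 - 1)) * (ENNReal.ofReal (t / 2) *
          volume {x | ENNReal.ofReal (t / 2) < maximalFn G x}) := by rw [e1]; ring
      _ ≤ 2 * ENNReal.ofReal (t ^ (q - 1 - 1)) * (5 ^ finrank ℝ E * ∫⁻ y, G y) := by gcongr
      _ = _ := by ring
  calc _ ≤ ENNReal.ofReal q * ∫⁻ t in Ioi (0 : ℝ), (2 * 5 ^ finrank ℝ E) *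
        (ENNReal.ofReal (t ^ (q - 1 - 1)) *
          ∫⁻ x, {x | ENNReal.ofReal t < 2 * g x}.indicator g x) := by
        exact mul_le_mul_right (setLIntegral_mono' measurableSet_Ioi hpt) _
    _ = ENNReal.ofReal q * ((2 * 5 ^ finrank ℝ E) *
        ((∫⁻ x, g x * (2 * g x) ^ (q - 1)) / ENNReal.ofReal (q - 1))) := by
        rw [lintegral_const_mul' _ _ (ENNReal.mul_ne_top (by simp) (by simp)),
          lintegral_rpow_layercake volume hq1 (hg.const_mul 2) hg]
    _ = ENNReal.ofReal q * ((2 * 5 ^ finrank ℝ E) *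
        ((2 ^ (q - 1) * ∫⁻ x, g x ^ q) / ENNReal.ofReal (q - 1))) := by
        rw [← lintegral_const_mul' _ _ (by simp)]
        congr 4
        ext x
        rw [ENNReal.mul_rpow_of_nonneg _ _ hq1.le, mul_left_comm]
        congr 1
        nth_rewrite 1 [← ENNReal.rpow_one (g x)]
        rw [← ENNReal.rpow_add_of_nonneg _ _ zero_le_one hq1.le, add_sub_cancel]
    _ = _ := by
        rw [hD]; simp only [div_eq_mul_inv]; ring

/-- Lebesgue differentiation along balls centred at `x` with radius tending to `0`. -/
theorem enorm_le_maximalFn_ae {F : Type*} [NormedAddCommGroup F] {f : E → F}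
    (hf : LocallyIntegrable f volume) :
    ∀ᵐ x, ‖f x‖ₑ ≤ maximalFn (fun y => ‖f y‖ₑ) x := by
  have hf : LocallyIntegrable (fun x => ‖f x‖) volume :=
    hf.mono hf.aestronglyMeasurable.norm (by simp)
  have h := IsUnifLocDoublingMeasure.ae_tendsto_average volume hf 1
  filter_upwards [h] with x hx
  have h1 := hx (l := nhdsWithin (0 : ℝ) (Ioi 0)) (fun _ => x) id Filter.tendsto_id
    (by filter_upwards [self_mem_nhdsWithin] with r hr using by
          simpa using (le_of_lt hr))
  have h2 := (ENNReal.continuous_ofReal.tendsto _).comp h1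
  rw [← ofReal_norm]
  refine le_of_tendsto h2 ?_
  filter_upwards [self_mem_nhdsWithin] with r hr
  have hr : 0 < r := hr
  -- The differentiation theorem uses closed balls and `maximalFn` open ones; spheres are null, and
  -- empty in dimension `0` since `r ≠ 0`.
  have hball : (closedBall x r : Set E) =ᵐ[volume] ball x r :=
    ((ae_eq_set.2 ⟨by
      rcases subsingleton_or_nontrivial E with hE | hE
      · have : closedBall x r \ ball x r = ∅ := by
          ext y; simp [Subsingleton.elim y x, hr.ne]
        simp [this]
      · rw [closedBall_sdiff_ball]; exact Measure.addHaar_sphere _ _ _,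
      by rw [sdiff_eq_empty.2 ball_subset_closedBall]; simp⟩))
  have hint : IntegrableOn (fun y => ‖f y‖) (ball x r) volume :=
    (hf.integrableOn_isCompact (isCompact_closedBall x r)).mono_set ball_subset_closedBall
  simp only [Function.comp, id, setAverage_eq, measureReal_congr hball,
    setIntegral_congr_set hball]
  rw [smul_eq_mul, inv_mul_eq_div, ENNReal.ofReal_div_of_pos (y := volume.real (ball x r))
    (ENNReal.toReal_pos (volume_ball_ne_zero x hr) (volume_ball_ne_top x r)),
    ofReal_integral_eq_lintegral_ofReal hint (.of_forall fun _ => norm_nonneg _),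
    ofReal_measureReal (volume_ball_ne_top x r)]
  simp only [ofReal_norm]
  exact le_iSup_of_le x (le_iSup_of_le r (le_iSup_of_le (mem_ball_self hr) le_rfl))

/-- Cauchy–Schwarz against `1` on each ball. -/
theorem maximalFn_sq_le {g : E → ℝ≥0∞} (hg : AEMeasurable g volume) (x : E) :
    maximalFn g x ^ (2 : ℝ) ≤ maximalFn (fun y => g y ^ (2 : ℝ)) x := by
  rw [← ENNReal.le_rpow_inv_iff two_pos]
  refine maximalFn_le_iff.2 fun c r hx => ?_
  have hr : 0 < r := pos_of_mem_ball hx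
  have h := ENNReal.lintegral_mul_le_Lp_mul_Lq (volume.restrict (ball c r))
    Real.HolderConjugate.two_two (hg.restrict (s := ball c r))
    (aemeasurable_const (b := (1 : ℝ≥0∞)))
  simp only [Pi.mul_apply, mul_one, ENNReal.one_rpow, lintegral_const, one_mul,
    Measure.restrict_apply_univ, one_div] at h
  refine h.trans ?_
  have h0 : volume (ball c r) = volume (ball c r) ^ (2⁻¹ : ℝ) * volume (ball c r) ^ (2⁻¹ : ℝ) := by
    rw [← ENNReal.rpow_add_of_nonneg _ _ (by norm_num) (by norm_num)]; norm_num
  conv_rhs => rw [h0]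
  rw [← mul_assoc]
  gcongr
  rw [← ENNReal.mul_rpow_of_nonneg _ _ (by norm_num), mul_comm]
  gcongr
  exact lintegral_ball_le_maximalFn _ hx

end MaximalFunction

/-! ### The Poisson-type majorant and its domination by the maximal function -/

section Majorant

open Metric Set Module

variable {E : Type*} [NormedAddCommGroup E] [InnerProductSpace ℝ E]

/-- The Poisson-type kernel `t⁻ᵈ (1 + |x| / t)⁻⁽ᵈ⁺¹⁾`, where `d` is the dimension. -/
noncomputable def poissonMaj (t : ℝ) (x : E) : ℝ := t / (t + ‖x‖) ^ (finrank ℝ E + 1)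

/-- Changing the base point costs only a factor independent of `y`. Hence finiteness of a maximal
function at one point gives absolute convergence of convolutions at every point. -/
theorem poissonMaj_one_le (x x₀ y : E) :
    poissonMaj 1 (x - y) ≤ (1 + ‖x₀ - x‖) ^ (finrank ℝ E + 1) * poissonMaj 1 (x₀ - y) := by
  rw [poissonMaj, poissonMaj, mul_one_div, div_le_div_iff₀ (by positivity) (by positivity),
    one_mul, ← mul_pow]
  gcongr
  have : ‖x₀ - y‖ ≤ ‖x₀ - x‖ + ‖x - y‖ := norm_sub_le_norm_sub_add_norm_sub _ _ _
  nlinarith [norm_nonneg (x₀ - x), norm_nonneg (x - y)]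

/-- Only the term with the least `k` such that `‖z‖ < 2 ^ k * t` is kept. If `k ≥ 1` then `‖z‖ ≥ 2 ^
(k - 1) * t`, and the factor `2 ^ (d + 1)` pays for this lost dyadic step. -/
theorem ofReal_poissonMaj_le_tsum {t : ℝ} (ht : 0 < t) (z : E) :
    ENNReal.ofReal (poissonMaj t z) ≤ ∑' k : ℕ,
      ENNReal.ofReal (2 ^ (finrank ℝ E + 1) * ((2 ^ k) ^ (finrank ℝ E + 1))⁻¹ *
        (t ^ finrank ℝ E)⁻¹) * (ball (0 : E) (2 ^ k * t)).indicator 1 z := by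
  set d := finrank ℝ E with hd
  have hex : ∃ k : ℕ, ‖z‖ < 2 ^ k * t := by
    obtain ⟨k, hk⟩ := pow_unbounded_of_one_lt (‖z‖ / t) (one_lt_two)
    exact ⟨k, (div_lt_iff₀ ht).1 hk⟩
  classical
  set k := Nat.find hex with hk
  have hkz : ‖z‖ < 2 ^ k * t := Nat.find_spec hex
  refine le_trans ?_ (ENNReal.le_tsum k)
  rw [indicator_of_mem (by simpa using hkz), Pi.one_apply, mul_one]
  refine ENNReal.ofReal_le_ofReal ?_
  have hz := norm_nonneg z
  have e : (t ^ d)⁻¹ = t / t ^ (d + 1) := by field_simp; ring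
  rw [poissonMaj, ← hd, e]
  rcases Nat.eq_zero_or_pos k with h0 | hpos
  · rw [h0]
    simp only [pow_zero, one_pow, inv_one, mul_one]
    have h1 : t / (t + ‖z‖) ^ (d + 1) ≤ t / t ^ (d + 1) := by gcongr; linarith
    have h2 : (1 : ℝ) ≤ 2 ^ (d + 1) := one_le_pow₀ one_le_two
    have h3 : 0 ≤ t / t ^ (d + 1) := by positivity
    nlinarith
  · obtain ⟨j, hj⟩ : ∃ j, k = j + 1 := ⟨k - 1, by omega⟩
    have hjz : 2 ^ j * t ≤ ‖z‖ := by
      have := Nat.find_min hex (m := j) (by omega)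
      exact not_lt.1 this
    rw [hj]
    have e2 : 2 ^ (d + 1) * ((2 ^ (j + 1)) ^ (d + 1))⁻¹ * (t / t ^ (d + 1)) =
        t / (2 ^ j * t) ^ (d + 1) := by
      rw [pow_succ (2 : ℝ) j, mul_pow, mul_pow]
      field_simp
    rw [e2]
    gcongr
    linarith

/-- The coefficient of the `k`-th dyadic ball times its volume is a multiple of `2 ^ (-k)`,
independently of `t`, so the averages over these balls are summed against a geometric series. -/
theorem exists_lintegral_poissonMaj_le (E : Type*) [NormedAddCommGroup E] [InnerProductSpace ℝ E]
    [FiniteDimensional ℝ E] [MeasurableSpace E] [BorelSpace E] [Nontrivial E] :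
    ∃ C : ℝ≥0, ∀ t : ℝ, 0 < t → ∀ g : E → ℝ≥0∞, AEMeasurable g volume → ∀ x : E,
      ∫⁻ y, ENNReal.ofReal (poissonMaj t (x - y)) * g y ≤ C * maximalFn g x := by
  set d := finrank ℝ E with hd
  set D : ℝ≥0∞ := ENNReal.ofReal (2 ^ (d + 1) * 2) * volume (ball (0 : E) 1) with hD
  have hDt : D ≠ ∞ := ENNReal.mul_ne_top ENNReal.ofReal_ne_top (volume_ball_ne_top _ _)
  refine ⟨D.toNNReal, fun t ht g hg x => ?_⟩
  rw [ENNReal.coe_toNNReal hDt]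
  set c : ℕ → ℝ := fun k => 2 ^ (d + 1) * ((2 ^ k) ^ (d + 1))⁻¹ * (t ^ d)⁻¹ with hc
  have hind : ∀ k : ℕ, ∀ y, (ball (0 : E) (2 ^ k * t)).indicator (1 : E → ℝ≥0∞) (x - y) * g y =
      (ball x (2 ^ k * t)).indicator g y := fun k y => by
    by_cases hy : y ∈ ball x (2 ^ k * t)
    · rw [indicator_of_mem hy, indicator_of_mem, Pi.one_apply, one_mul]
      rw [mem_ball_zero_iff]; rwa [mem_ball, dist_comm, dist_eq_norm] at hy
    · rw [indicator_of_notMem hy, indicator_of_notMem, zero_mul]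
      rw [mem_ball_zero_iff]; rwa [mem_ball, dist_comm, dist_eq_norm] at hy
  calc ∫⁻ y, ENNReal.ofReal (poissonMaj t (x - y)) * g y
      ≤ ∫⁻ y, ∑' k : ℕ, ENNReal.ofReal (c k) * (ball x (2 ^ k * t)).indicator g y := by
        refine lintegral_mono fun y => ?_
        refine (mul_le_mul_left (ofReal_poissonMaj_le_tsum ht (x - y)) _).trans_eq ?_
        rw [← ENNReal.tsum_mul_right]
        refine tsum_congr fun k => ?_
        rw [mul_assoc, hind]
    _ = ∑' k : ℕ, ENNReal.ofReal (c k) * ∫⁻ y in ball x (2 ^ k * t), g y := by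
        rw [lintegral_tsum]
        · refine tsum_congr fun k => ?_
          rw [lintegral_const_mul' _ _ ENNReal.ofReal_ne_top,
            lintegral_indicator measurableSet_ball]
        · exact fun k => (hg.indicator measurableSet_ball).const_mul _
    _ ≤ ∑' k : ℕ, ENNReal.ofReal (2 ^ (d + 1) * (1 / 2) ^ k) *
        (volume (ball (0 : E) 1) * maximalFn g x) := by
        refine ENNReal.tsum_le_tsum fun k => ?_
        have hpos : 0 < 2 ^ k * t := by positivity
        refine (mul_le_mul_right (lintegral_ball_le_maximalFn g (mem_ball_self hpos)) _).trans_eq ?_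
        rw [Measure.addHaar_ball _ _ hpos.le, ← mul_assoc, ← mul_assoc, ← mul_assoc,
          ← ENNReal.ofReal_mul (by positivity)]
        congr 3
        simp only [hc, ← hd, one_div, inv_pow, pow_succ _ d, mul_pow]
        field_simp
    _ = _ := by
        rw [ENNReal.tsum_mul_right, hD, ← mul_assoc]
        congr 2
        rw [← ENNReal.ofReal_tsum_of_nonneg (fun _ => by positivity)
          ((summable_geometric_two).mul_left _), tsum_mul_left, tsum_geometric_two]

end Majorant

/-! ### Pointwise decay and difference estimates for Schwartz functions -/

section Schwartz

open Module

variable {V F : Type*} [NormedAddCommGroup V] [NormedSpace ℝ V] [NormedAddCommGroup F]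
  [NormedSpace ℝ F]

theorem SchwartzMap.exists_decay (φ : 𝓢(V, F)) (m : ℕ) :
    ∃ C : ℝ, 0 < C ∧ ∀ x, ‖φ x‖ ≤ C / (1 + ‖x‖) ^ m ∧ ‖fderiv ℝ φ x‖ ≤ C / (1 + ‖x‖) ^ m := by
  set S := 2 ^ (m, 1).1 *
    ((Finset.Iic (m, 1)).sup fun m => SchwartzMap.seminorm ℝ m.1 m.2) φ with hS
  refine ⟨|S| + 1, by positivity, fun x => ?_⟩
  have h0 := SchwartzMap.one_add_le_sup_seminorm_apply (𝕜 := ℝ) (m := (m, 1)) le_rfl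
    (zero_le_one) φ x
  have h1 := SchwartzMap.one_add_le_sup_seminorm_apply (𝕜 := ℝ) (m := (m, 1)) le_rfl le_rfl φ x
  rw [norm_iteratedFDeriv_zero, ← hS] at h0
  rw [norm_iteratedFDeriv_one, ← hS] at h1
  have := le_abs_self S
  have hx : 0 < (1 + ‖x‖) ^ m := by positivity
  rw [le_div_iff₀ hx, le_div_iff₀ hx]
  constructor <;> linarith

/-- Mean value inequality on the ball of radius `‖z‖` about `x`. In general `1 + ‖x‖ ≤ (1 + ‖w‖) (1
+ ‖z‖)` there, which loses a power of `1 + ‖z‖`; when `‖z‖ ≤ ‖x‖ / 2` every such `w` has norm at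
least `‖x‖ / 2` and nothing is lost. -/
theorem SchwartzMap.exists_diff_le (φ : 𝓢(V, F)) (m : ℕ) :
    ∃ C : ℝ, 0 < C ∧ ∀ x z,
      ‖φ (x - z) - φ x‖ ≤ C * ‖z‖ * (1 + ‖z‖) ^ m / (1 + ‖x‖) ^ m ∧
      (‖z‖ ≤ ‖x‖ / 2 → ‖φ (x - z) - φ x‖ ≤ C * ‖z‖ / (1 + ‖x‖) ^ m) := by
  obtain ⟨C, hC, h⟩ := φ.exists_decay m
  have hseg : ∀ x z : V, ∀ B : ℝ, (∀ w, ‖x - w‖ ≤ ‖z‖ → C / (1 + ‖w‖) ^ m ≤ B) →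
      ‖φ (x - z) - φ x‖ ≤ B * ‖z‖ := fun x z B hB => by
    have := (convex_closedBall x ‖z‖).norm_image_sub_le_of_norm_fderiv_le (𝕜 := ℝ) (f := φ)
      (C := B) (x := x) (y := x - z) (fun w _ => φ.differentiableAt)
      (fun w hw => ((h w).2).trans (hB w (by
        rwa [Metric.mem_closedBall, dist_comm, dist_eq_norm] at hw)))
      (by simp) (by simp)
    simpa using this
  refine ⟨2 ^ m * C, by positivity, fun x z => ⟨?_, fun hz => ?_⟩⟩
  · refine (hseg x z (C * (1 + ‖z‖) ^ m / (1 + ‖x‖) ^ m) fun w hw => ?_).trans ?_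
    · rw [div_le_div_iff₀ (by positivity) (by positivity), mul_assoc, ← mul_pow]
      have : ‖x‖ ≤ ‖w‖ + ‖z‖ := by
        calc ‖x‖ = ‖w + (x - w)‖ := by congr 1; abel
          _ ≤ _ := (norm_add_le _ _).trans (by gcongr)
      gcongr
      nlinarith [norm_nonneg w, norm_nonneg z]
    · have h2 : (1 : ℝ) ≤ 2 ^ m := one_le_pow₀ one_le_two
      have h3 : 0 ≤ C * (1 + ‖z‖) ^ m / (1 + ‖x‖) ^ m * ‖z‖ := by positivity
      calc _ ≤ 2 ^ m * (C * (1 + ‖z‖) ^ m / (1 + ‖x‖) ^ m * ‖z‖) := le_mul_of_one_le_left h3 h2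
        _ = _ := by ring
  · refine (hseg x z (2 ^ m * C / (1 + ‖x‖) ^ m) fun w hw => ?_).trans_eq (by ring)
    rw [div_le_div_iff₀ (by positivity) (by positivity), mul_comm (2 ^ m) C, mul_assoc, ← mul_pow]
    have : ‖x‖ ≤ ‖w‖ + ‖z‖ := by
      calc ‖x‖ = ‖w + (x - w)‖ := by congr 1; abel
        _ ≤ _ := (norm_add_le _ _).trans (by gcongr)
    gcongr
    linarith

theorem SchwartzMap.exists_norm_le_poissonMaj {E : Type*} [NormedAddCommGroup E]
    [InnerProductSpace ℝ E] (κ : 𝓢(E, ℂ)) :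
    ∃ B : ℝ≥0, ∀ x, ‖κ x‖ ≤ B * poissonMaj 1 x := by
  obtain ⟨C, hC, h⟩ := κ.exists_decay (finrank ℝ E + 1)
  refine ⟨⟨C, hC.le⟩, fun x => (h x).1.trans_eq ?_⟩
  rw [poissonMaj, mul_one_div]; rfl

end Schwartz

/-! ### Estimates for dilates, uniform in the scale -/

section Dilate

open Module

variable {n : ℕ}

theorem dilate_sub_dilate (φ : EuclideanSpace ℝ (Fin n) → ℝ) {t : ℝ} (ht : 0 < t)
    (x z : EuclideanSpace ℝ (Fin n)) :
    |dilate φ t (x - z) - dilate φ t x| =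
      (t ^ n)⁻¹ * |φ (t⁻¹ • x - t⁻¹ • z) - φ (t⁻¹ • x)| := by
  rw [dilate, dilate, smul_sub, ← mul_sub, abs_mul, abs_of_pos (by positivity)]

theorem exists_dilate_le (φ : 𝓢(EuclideanSpace ℝ (Fin n), ℝ)) :
    ∃ C : ℝ, 0 < C ∧ ∀ t, 0 < t → ∀ x, |dilate φ t x| ≤ C * poissonMaj t x := by
  obtain ⟨C, hC, h⟩ := φ.exists_decay (n + 1)
  refine ⟨C, hC, fun t ht x => ?_⟩
  have h1 := (h (t⁻¹ • x)).1
  rw [Real.norm_eq_abs, norm_smul, Real.norm_of_nonneg (by positivity)] at h1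
  rw [dilate, abs_mul, abs_of_pos (by positivity), poissonMaj, finrank_euclideanSpace_fin]
  calc (t ^ n)⁻¹ * |φ (t⁻¹ • x)| ≤ (t ^ n)⁻¹ * (C / (1 + t⁻¹ * ‖x‖) ^ (n + 1)) := by gcongr
    _ = _ := by
      rw [show 1 + t⁻¹ * ‖x‖ = (t + ‖x‖) / t by field_simp, div_pow]
      have := norm_nonneg x
      field_simp
      ring

theorem exists_dilate_diff_le (φ : 𝓢(EuclideanSpace ℝ (Fin n), ℝ)) :
    ∃ C : ℝ, 0 < C ∧ ∀ t, 0 < t → ∀ x z, |dilate φ t (x - z) - dilate φ t x| ≤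
      C * (‖z‖ / t * (1 + ‖z‖ / t) ^ (n + 1)) * poissonMaj t x := by
  obtain ⟨C, hC, h⟩ := φ.exists_diff_le (n + 1)
  refine ⟨C, hC, fun t ht x z => ?_⟩
  have h1 := (h (t⁻¹ • x) (t⁻¹ • z)).1
  rw [Real.norm_eq_abs, norm_smul, norm_smul, Real.norm_of_nonneg (by positivity)] at h1
  rw [dilate_sub_dilate _ ht, poissonMaj, finrank_euclideanSpace_fin]
  refine (mul_le_mul_of_nonneg_left h1 (by positivity)).trans_eq ?_
  rw [show 1 + t⁻¹ * ‖x‖ = (t + ‖x‖) / t by field_simp, div_pow, inv_mul_eq_div]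
  have := norm_nonneg x
  field_simp
  ring

/-- Decay of order `n + 2` gives `‖z‖ t / (t + ‖x‖) ^ (n + 2)`. Bounding the denominator below by
`‖x‖ ^ (n + 2)` or by `t ^ 2 * ‖x‖ ^ n` yields the two entries of the minimum, which makes the
estimate summable over lacunary scales. -/
theorem exists_dilate_diff_le_min (φ : 𝓢(EuclideanSpace ℝ (Fin n), ℝ)) :
    ∃ C : ℝ, 0 < C ∧ ∀ t, 0 < t → ∀ x z, x ≠ 0 → ‖z‖ ≤ ‖x‖ / 2 →
      |dilate φ t (x - z) - dilate φ t x| ≤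
        C * (‖z‖ / ‖x‖ ^ (n + 1)) * min (t / ‖x‖) (‖x‖ / t) := by
  obtain ⟨C, hC, h⟩ := φ.exists_diff_le (n + 2)
  refine ⟨C, hC, fun t ht x z hx hz => ?_⟩
  have h1 := (h (t⁻¹ • x) (t⁻¹ • z)).2
  rw [Real.norm_eq_abs, norm_smul, norm_smul, Real.norm_of_nonneg (by positivity), mul_div_assoc] at h1
  have h1 := h1 (by gcongr)
  have hx := norm_pos_iff.2 hx
  rw [dilate_sub_dilate _ ht]
  have h2 : (t ^ n)⁻¹ * |φ (t⁻¹ • x - t⁻¹ • z) - φ (t⁻¹ • x)| ≤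
      C * ‖z‖ * (t / (t + ‖x‖) ^ (n + 2)) := by
    refine (mul_le_mul_of_nonneg_left h1 (by positivity)).trans_eq ?_
    rw [show 1 + t⁻¹ * ‖x‖ = (t + ‖x‖) / t by field_simp, div_pow]
    field_simp
    ring
  refine h2.trans ?_
  rw [mul_div_assoc', mul_div_assoc', mul_min_of_nonneg _ _ (by positivity)]
  refine le_min ?_ ?_
  · calc C * ‖z‖ * t / (t + ‖x‖) ^ (n + 2) ≤ C * ‖z‖ * t / (‖x‖) ^ (n + 2) := by
          gcongr; linarith
      _ = _ := by field_simp; ring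
  · calc C * ‖z‖ * t / (t + ‖x‖) ^ (n + 2) ≤ C * ‖z‖ * t / (t ^ 2 * ‖x‖ ^ n) := by
          rw [pow_add, mul_comm (_ ^ n)]
          gcongr <;> linarith
      _ = _ := by field_simp; ring

end Dilate

/-! ### Summation over lacunary scales -/

section Lacunary

theorem sum_Icc_int_sub (g : ℤ → ℝ) {N₁ N₂ : ℤ} (h : N₁ ≤ N₂) :
    ∑ i ∈ Finset.Icc N₁ N₂, (g (i + 1) - g i) = g (N₂ + 1) - g N₁ := by
  induction N₂, h using Int.leInduction with
  | base => simp
  | succ k hk ih =>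
    rw [← Finset.insert_Icc_right_eq_Icc_add_one (by omega), Finset.sum_insert (by simp), ih]
    ring

variable {δ : ℝ} {a : ℤ → ℝ}

theorem IsLacunary.mul_le (ha : IsLacunary δ a) (i : ℤ) : δ * a i ≤ a (i + 1) :=
  (le_div_iff₀ (ha.pos i)).1 (ha.ratio i)

theorem IsLacunary.shift (ha : IsLacunary δ a) : IsLacunary δ (fun i => a (i + 1)) :=
  ⟨fun _ => ha.pos _, fun _ => ha.ratio _⟩

theorem IsLacunary.lt_succ (ha : IsLacunary δ a) (hδ : 1 < δ) (i : ℤ) : a i < a (i + 1) := by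
  have := ha.mul_le i
  nlinarith [ha.pos i]

theorem IsLacunary.strictMono (ha : IsLacunary δ a) (hδ : 1 < δ) : StrictMono a :=
  strictMono_int_of_lt_succ (ha.lt_succ hδ)

/-- Comparison with telescoping sums: each term is at most `δ / (δ - 1)` times the increment of two
increasing sequences whose total variation is at most `1` each. -/
theorem IsLacunary.sum_min_le (ha : IsLacunary δ a) (hδ : 1 < δ) {R : ℝ} (hR : 0 < R)
    (N₁ N₂ : ℤ) :
    ∑ i ∈ Finset.Icc N₁ N₂, min (a i / R) (R / a i) ≤ 2 * (δ / (δ - 1)) := by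
  have hδ' : 0 < δ - 1 := by linarith
  have hκ : 0 < δ / (δ - 1) := by positivity
  rcases lt_or_ge N₂ N₁ with hN | hN
  · rw [Finset.Icc_eq_empty_of_lt hN, Finset.sum_empty]; positivity
  -- `u` handles `a i ≤ R` and `w` handles `a i ≥ R`. The shift to `i - 1` makes `u (i + 1) - u i`
  -- at least `(1 - 1 / δ) * (a i / R)` in its range.
  set u : ℤ → ℝ := fun i => min (a (i - 1) / R) 1 with hu
  set w : ℤ → ℝ := fun i => - min (R / a i) 1 with hw
  have hpt : ∀ i, min (a i / R) (R / a i) ≤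
      δ / (δ - 1) * ((u (i + 1) - u i) + (w (i + 1) - w i)) := by
    intro i
    have hp := ha.pos i
    have hp1 := ha.pos (i + 1)
    have hp0 := ha.pos (i - 1)
    have hm := ha.mul_le i
    have hm0 := ha.mul_le (i - 1)
    rw [sub_add_cancel] at hm0
    have hu1 : 0 ≤ u (i + 1) - u i := by
      simp only [hu, add_sub_cancel_right, sub_nonneg]
      gcongr
      nlinarith
    have hw1 : 0 ≤ w (i + 1) - w i := by
      simp only [hw, sub_nonneg, neg_le_neg_iff]
      gcongr
      nlinarith
    have e : δ / (δ - 1) * (1 - 1 / δ) = 1 := by field_simp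
    rcases le_total (a i) R with h | h
    · have h1 : u (i + 1) = a i / R := by
        simp only [hu, add_sub_cancel_right]
        exact min_eq_left ((div_le_one hR).2 h)
      have h2 : u i ≤ 1 / δ * (a i / R) := by
        refine (min_le_left _ _).trans ?_
        rw [one_div, inv_mul_eq_div, div_div, div_le_div_iff₀ hR (by positivity)]
        nlinarith
      calc _ ≤ a i / R := min_le_left _ _
        _ = δ / (δ - 1) * (1 - 1 / δ) * (a i / R) := by rw [e, one_mul]
        _ ≤ _ := by
          rw [mul_assoc]
          gcongr
          linarith
    · have h1 : w i = - (R / a i) := by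
        simp only [hw, neg_inj]
        exact min_eq_left ((div_le_one hp).2 h)
      have h2 : - (1 / δ * (R / a i)) ≤ w (i + 1) := by
        simp only [hw, neg_le_neg_iff]
        refine (min_le_left _ _).trans ?_
        rw [one_div, inv_mul_eq_div, div_div, div_le_div_iff₀ hp1 (by positivity)]
        nlinarith
      calc _ ≤ R / a i := min_le_right _ _
        _ = δ / (δ - 1) * (1 - 1 / δ) * (R / a i) := by rw [e, one_mul]
        _ ≤ _ := by
          rw [mul_assoc]
          gcongr
          linarith
  refine (Finset.sum_le_sum fun i _ => hpt i).trans ?_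
  rw [← Finset.mul_sum, Finset.sum_add_distrib, sum_Icc_int_sub u hN, sum_Icc_int_sub w hN,
    mul_comm 2]
  gcongr
  have h1 : u (N₂ + 1) ≤ 1 := min_le_right _ _
  have h2 : 0 ≤ u N₁ := le_min (div_nonneg (ha.pos _).le hR.le) zero_le_one
  have h3 : w (N₂ + 1) ≤ 0 :=
    neg_nonpos.2 (le_min (div_nonneg hR.le (ha.pos _).le) zero_le_one)
  have h4 : -1 ≤ w N₁ := neg_le_neg (min_le_right _ _)
  linarith

end Lacunary

/-! ### Calderón–Zygmund kernels and the local good-`λ` estimate -/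

section CalderonZygmund

open Metric Set Module

variable {E : Type*} [NormedAddCommGroup E] [InnerProductSpace ℝ E] [FiniteDimensional ℝ E]
  [MeasurableSpace E] [BorelSpace E]

/-- Convolution of a complex-valued function with a complex-valued kernel. -/
noncomputable def convOp (K f : E → ℂ) (x : E) : ℂ := ∫ y, K (x - y) * f y

/-- A continuous kernel which is dominated by the Poisson-type kernel (with an arbitrary constant),
whose convolution operator is bounded on `L²` with constant `A` and which satisfies the
Lipschitz-type smoothness condition with constant `A`. -/
structure IsCZKernel (A : ℝ≥0) (K : E → ℂ) : Prop where
  continuous : Continuous K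
  bound : ∃ B : ℝ≥0, ∀ x, ‖K x‖ ≤ B * poissonMaj 1 x
  l2_bound : ∀ f : E → ℂ, MemLp f 2 volume →
    ∫⁻ x, ‖convOp K f x‖ₑ ^ (2 : ℝ) ≤ A * ∫⁻ x, ‖f x‖ₑ ^ (2 : ℝ)
  smooth : ∀ x z, ‖z‖ ≤ ‖x‖ / 2 → ‖K (x - z) - K x‖ ≤ A * (‖z‖ / ‖x‖ ^ (finrank ℝ E + 1))

theorem lintegral_mul_lt_top_of_bound [Nontrivial E] {K : E → ℂ}
    (hK : ∃ B : ℝ≥0, ∀ x, ‖K x‖ ≤ B * poissonMaj 1 x)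
    {f : E → ℂ} (hf : AEStronglyMeasurable f volume) {x₀ : E}
    (h : maximalFn (fun y => ‖f y‖ₑ) x₀ ≠ ∞) (x : E) :
    ∫⁻ y, ‖K (x - y) * f y‖ₑ < ∞ := by
  obtain ⟨B, hB⟩ := hK
  obtain ⟨C, hC⟩ := exists_lintegral_poissonMaj_le E
  set D : ℝ := B * (1 + ‖x₀ - x‖) ^ (finrank ℝ E + 1) with hD
  calc ∫⁻ y, ‖K (x - y) * f y‖ₑ
      ≤ ∫⁻ y, ENNReal.ofReal D * (ENNReal.ofReal (poissonMaj 1 (x₀ - y)) * ‖f y‖ₑ) := by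
        refine lintegral_mono fun y => ?_
        rw [enorm_mul, ← mul_assoc, ← ENNReal.ofReal_mul (by positivity), ← ofReal_norm]
        gcongr
        refine (hB _).trans ?_
        rw [hD, mul_assoc]
        gcongr
        exact poissonMaj_one_le _ _ _
    _ ≤ ENNReal.ofReal D * (C * maximalFn (fun y => ‖f y‖ₑ) x₀) := by
        rw [lintegral_const_mul' _ _ ENNReal.ofReal_ne_top]
        gcongr
        exact hC 1 one_pos _ hf.enorm x₀
    _ < ∞ := ENNReal.mul_lt_top ENNReal.ofReal_lt_top
        (ENNReal.mul_lt_top ENNReal.coe_lt_top h.lt_top)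

theorem aestronglyMeasurable_kernel_mul {K f : E → ℂ} (hK : Continuous K)
    (hf : AEStronglyMeasurable f volume) (x : E) :
    AEStronglyMeasurable (fun y => K (x - y) * f y) volume :=
  (hK.comp (continuous_const.sub continuous_id)).aestronglyMeasurable.mul hf

theorem integrable_kernel_mul [Nontrivial E] {K : E → ℂ} (hc : Continuous K)
    (hK : ∃ B : ℝ≥0, ∀ x, ‖K x‖ ≤ B * poissonMaj 1 x)
    {f : E → ℂ} (hf : AEStronglyMeasurable f volume) {x₀ : E}
    (h : maximalFn (fun y => ‖f y‖ₑ) x₀ ≠ ∞) (x : E) :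
    Integrable (fun y => K (x - y) * f y) volume :=
  ⟨aestronglyMeasurable_kernel_mul hc hf x, lintegral_mul_lt_top_of_bound hK hf h x⟩

theorem aestronglyMeasurable_convOp {K f : E → ℂ} (hK : Continuous K)
    (hf : AEStronglyMeasurable f volume) : AEStronglyMeasurable (convOp K f) volume := by
  have h : AEStronglyMeasurable (fun z : E × E => K (z.1 - z.2) * f z.2)
      (volume.prod volume) :=
    (hK.comp (continuous_fst.sub continuous_snd)).aestronglyMeasurable.mul hf.comp_snd
  exact h.integral_prod_right'

/-- The constant does not depend on `t`: Cotlar's inequality uses this at the scale `a N`, while `t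
= 1` gives the qualitative bounds. -/
theorem exists_enorm_convOp_le (E : Type*) [NormedAddCommGroup E] [InnerProductSpace ℝ E]
    [FiniteDimensional ℝ E] [MeasurableSpace E] [BorelSpace E] [Nontrivial E] :
    ∃ C : ℝ≥0, ∀ (t : ℝ) (B : ℝ≥0) (K f : E → ℂ), 0 < t → AEStronglyMeasurable f volume →
      (∀ x, ‖K x‖ ≤ B * poissonMaj t x) →
      ∀ x, ‖convOp K f x‖ₑ ≤ B * C * maximalFn (fun y => ‖f y‖ₑ) x := by
  obtain ⟨C, hC⟩ := exists_lintegral_poissonMaj_le E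
  refine ⟨C, fun t B K f ht hf hK x => ?_⟩
  calc ‖convOp K f x‖ₑ ≤ ∫⁻ y, ‖K (x - y) * f y‖ₑ := enorm_integral_le_lintegral_enorm _
    _ ≤ ∫⁻ y, B * (ENNReal.ofReal (poissonMaj t (x - y)) * ‖f y‖ₑ) := by
        refine lintegral_mono fun y => ?_
        rw [enorm_mul, ← mul_assoc, ← ENNReal.ofReal_coe_nnreal,
          ← ENNReal.ofReal_mul (by positivity), ← ofReal_norm]
        gcongr
        exact hK _
    _ ≤ _ := by
        rw [lintegral_const_mul' _ _ ENNReal.coe_ne_top, mul_assoc]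
        gcongr
        exact hC t ht _ hf.enorm x

theorem maximalFn_ae_ne_top [Nontrivial E] {q : ℝ} (hq : 1 < q) {g : E → ℝ≥0∞}
    (hg : AEMeasurable g volume) (h : ∫⁻ x, g x ^ q ≠ ∞) :
    ∀ᵐ x, maximalFn g x ≠ ∞ := by
  obtain ⟨C, hC⟩ := strong_type_maximalFn E hq
  have := ae_lt_top ((measurable_maximalFn g).pow_const q)
    ((hC g hg).trans_lt (ENNReal.mul_lt_top ENNReal.coe_lt_top h.lt_top)).ne
  filter_upwards [this] with x hx htop
  rw [htop, ENNReal.top_rpow_of_pos (by linarith)] at hx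
  exact lt_irrefl _ hx

theorem convOp_indicator_add [Nontrivial E] {K : E → ℂ} (hc : Continuous K)
    (hK : ∃ B : ℝ≥0, ∀ x, ‖K x‖ ≤ B * poissonMaj 1 x)
    {f : E → ℂ} (hf : AEStronglyMeasurable f volume) {x₀ : E}
    (h : maximalFn (fun y => ‖f y‖ₑ) x₀ ≠ ∞) {S : Set E} (hS : MeasurableSet S) (x : E) :
    convOp K f x = convOp K (S.indicator f) x + convOp K (Sᶜ.indicator f) x := by
  have hi := integrable_kernel_mul hc hK hf h x
  have e : ∀ T : Set E, (fun y => K (x - y) * T.indicator f y) =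
      T.indicator fun y => K (x - y) * f y := fun T => by
    ext y; by_cases hy : y ∈ T <;> simp [hy]
  rw [convOp, convOp, convOp, e, e, integral_indicator hS, integral_indicator hS.compl,
    integral_add_compl hS hi]

/-- The oscillation on a ball of the convolution of a Calderón–Zygmund kernel with a function
supported away from that ball. -/
theorem exists_oscillation_le (E : Type*) [NormedAddCommGroup E] [InnerProductSpace ℝ E]
    [FiniteDimensional ℝ E] [MeasurableSpace E] [BorelSpace E] [Nontrivial E] (A : ℝ≥0) :
    ∃ c : ℝ≥0, ∀ K : E → ℂ, IsCZKernel A K → ∀ f : E → ℂ, AEStronglyMeasurable f volume →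
      ∀ (x x₁ : E) (r : ℝ), 0 < r → x₁ ∈ ball x (5 * r) →
      maximalFn (fun y => ‖f y‖ₑ) x₁ ≠ ∞ →
      ∀ y ∈ ball x (16 * r), ∀ y' ∈ ball x (16 * r),
        ‖convOp K ((ball x (100 * r))ᶜ.indicator f) y -
          convOp K ((ball x (100 * r))ᶜ.indicator f) y'‖ₑ ≤
          c * maximalFn (fun y => ‖f y‖ₑ) x₁ := by
  obtain ⟨C, hC⟩ := exists_lintegral_poissonMaj_le E
  set d := finrank ℝ E with hd
  -- `32` bounds `‖y - y'‖ / r`, `2 ^ (d + 1)` comes from `r + ‖x₁ - ξ‖ ≤ 2 * ‖y - ξ‖`, and `C` from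
  -- the Poisson majorant of width `r` at `x₁`.
  refine ⟨A * 32 * 2 ^ (d + 1) * C, fun K hK f hf x x₁ r hr hx₁ hM y hy y' hy' => ?_⟩
  set S := (ball x (100 * r))ᶜ with hS
  have hSm : MeasurableSet S := measurableSet_ball.compl
  have hfS : AEStronglyMeasurable (S.indicator f) volume := hf.indicator hSm
  have hMS : maximalFn (fun y => ‖S.indicator f y‖ₑ) x₁ ≠ ∞ := by
    refine ((maximalFn_mono (fun y => ?_) x₁).trans_lt hM.lt_top).ne
    exact enorm_indicator_le_enorm_self _ _
  have h1 := integrable_kernel_mul hK.continuous hK.bound hfS hMS y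
  have h2 := integrable_kernel_mul hK.continuous hK.bound hfS hMS y'
  rw [convOp, convOp, ← integral_sub h1 h2]
  refine (enorm_integral_le_lintegral_enorm _).trans ?_
  calc ∫⁻ ξ, ‖K (y - ξ) * S.indicator f ξ - K (y' - ξ) * S.indicator f ξ‖ₑ
      ≤ ∫⁻ ξ, ENNReal.ofReal (A * 32 * 2 ^ (d + 1)) *
          (ENNReal.ofReal (poissonMaj r (x₁ - ξ)) * ‖f ξ‖ₑ) := by
        refine lintegral_mono fun ξ => ?_
        by_cases hξ : ξ ∈ S
        · rw [indicator_of_mem hξ, ← sub_mul, enorm_mul, ← mul_assoc,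
            ← ENNReal.ofReal_mul (by positivity), ← ofReal_norm]
          gcongr
          have hξx : 100 * r ≤ ‖x - ξ‖ := by
            rw [hS, mem_compl_iff, mem_ball, not_lt, dist_comm, dist_eq_norm] at hξ
            exact hξ
          rw [mem_ball, dist_eq_norm] at hy hy' hx₁
          have e1 : ‖y - y'‖ ≤ 32 * r := by
            have := norm_sub_le_norm_sub_add_norm_sub y x y'
            rw [norm_sub_rev x y'] at this
            linarith
          have e2 : 84 * r ≤ ‖y - ξ‖ := by
            have := norm_sub_le_norm_sub_add_norm_sub x y ξ
            rw [norm_sub_rev x y] at this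
            linarith
          have e3 : r + ‖x₁ - ξ‖ ≤ 2 * ‖y - ξ‖ := by
            have h3 := norm_sub_le_norm_sub_add_norm_sub x₁ x ξ
            have h4 := norm_sub_le_norm_sub_add_norm_sub x y ξ
            rw [norm_sub_rev x y] at h4
            linarith
          have h5 := hK.smooth (y - ξ) (y - y') (by linarith)
          rw [show y - ξ - (y - y') = y' - ξ by abel, norm_sub_rev] at h5
          refine h5.trans ?_
          rw [poissonMaj, ← hd]
          calc A * (‖y - y'‖ / ‖y - ξ‖ ^ (d + 1))
              ≤ A * (32 * r / ((r + ‖x₁ - ξ‖) / 2) ^ (d + 1)) := by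
                gcongr
                linarith
            _ = _ := by
                rw [div_pow]
                field_simp
        · simp [indicator_of_notMem hξ]
    _ ≤ _ := by
        rw [lintegral_const_mul' _ _ ENNReal.ofReal_ne_top]
        have e : ((A * 32 * 2 ^ (d + 1) * C : ℝ≥0) : ℝ≥0∞) =
            ENNReal.ofReal (A * 32 * 2 ^ (d + 1)) * C := by
          rw [ENNReal.coe_mul, ← ENNReal.ofReal_coe_nnreal]; norm_num
        rw [e, mul_assoc (ENNReal.ofReal _)]
        gcongr
        exact hC r hr _ hf.enorm x₁

theorem mul_le_sq_add_sq (a b : ℝ≥0∞) : a * b ≤ a ^ (2 : ℝ) + b ^ (2 : ℝ) := by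
  rw [ENNReal.rpow_two, ENNReal.rpow_two]
  rcases le_total a b with h | h
  · exact le_add_left ((mul_le_mul_left h b).trans_eq (sq b).symm)
  · exact le_add_right ((mul_le_mul_right h a).trans_eq (sq a).symm)

/-- The local part of the good-`λ` inequality. -/
theorem exists_good_lambda_local (E : Type*) [NormedAddCommGroup E] [InnerProductSpace ℝ E]
    [FiniteDimensional ℝ E] [MeasurableSpace E] [BorelSpace E] [Nontrivial E] (A : ℝ≥0) :
    ∃ A₀ D : ℝ≥0, 1 ≤ A₀ ∧ ∀ K : E → ℂ, IsCZKernel A K →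
      ∀ f : E → ℂ, AEStronglyMeasurable f volume →
      ∀ (l γ : ℝ≥0) (x z : E) (r : ℝ), 0 < l → γ ≤ 1 → 0 < r → dist x z ≤ 10 * r →
      maximalFn (fun y => ‖convOp K f y‖ₑ) z ≤ l →
      volume ({y | A₀ * l < maximalFn (fun y => ‖convOp K f y‖ₑ) y ∧
        maximalFn (fun y => ‖f y‖ₑ ^ (2 : ℝ)) y ≤ (γ * l) ^ (2 : ℝ)} ∩ ball x (5 * r)) ≤
      D * γ ^ (2 : ℝ) * volume (ball x r) := by
  obtain ⟨c₁, hc₁⟩ := exists_oscillation_le E A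
  obtain ⟨C₂, hC₂⟩ := strong_type_maximalFn E one_lt_two
  set d := finrank ℝ E with hd
  -- `c₀ * l` will bound the far part `T₂` on `Q`: oscillation, average of `F`, average of `T₁`. In
  -- the threshold `5 ^ d + c₀ + 1` the `5 ^ d` excludes large balls and the last `1` leaves height
  -- `l` to `T₁`.
  set c₀ : ℝ≥0 := c₁ + 1 + (1 + A * 100 ^ d) with hc₀
  refine ⟨5 ^ d + c₀ + 1, C₂ * (A * 100 ^ d), le_add_self, ?_⟩
  intro K hK f hf l γ x z r hl hγ hr hz hMz
  rcases eq_empty_or_nonempty ({y | ↑(5 ^ d + c₀ + 1) * l <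
      maximalFn (fun y => ‖convOp K f y‖ₑ) y ∧ maximalFn (fun y => ‖f y‖ₑ ^ (2 : ℝ)) y ≤
      (γ * l) ^ (2 : ℝ)} ∩ ball x (5 * r)) with hemp | ⟨x₁, ⟨-, hW⟩, hx₁⟩
  · rw [hemp]; simp
  have hMf : maximalFn (fun y => ‖f y‖ₑ) x₁ ≤ γ * l :=
    (ENNReal.rpow_le_rpow_iff two_pos).1 ((maximalFn_sq_le hf.enorm x₁).trans hW)
  have hMft : maximalFn (fun y => ‖f y‖ₑ) x₁ ≠ ∞ := (hMf.trans_lt (by finiteness)).ne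
  have hl0 : (l : ℝ≥0∞) ≠ 0 := by exact_mod_cast hl.ne'
  set B := ball x (100 * r) with hB
  set f₁ := B.indicator f with hf₁
  set F := fun y => ‖convOp K f y‖ₑ with hF
  set T₁ := fun y => ‖convOp K f₁ y‖ₑ with hT₁
  set T₂ := fun y => convOp K (Bᶜ.indicator f) y with hT₂
  have hf₁m : AEStronglyMeasurable f₁ volume := hf.indicator measurableSet_ball
  have hT₁m : AEMeasurable T₁ volume := (aestronglyMeasurable_convOp hK.continuous hf₁m).enorm
  have hFm : AEMeasurable F volume := (aestronglyMeasurable_convOp hK.continuous hf).enorm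
  -- The ball `B` contains `x₁`, where the maximal function of `|f|²` is at most `(γ l)²`.
  have hf₁2 : ∫⁻ y, ‖f₁ y‖ₑ ^ (2 : ℝ) ≤ 100 ^ d * volume (ball x r) * (γ * l) ^ (2 : ℝ) := by
    have e : (fun y => ‖f₁ y‖ₑ ^ (2 : ℝ)) = B.indicator fun y => ‖f y‖ₑ ^ (2 : ℝ) := by
      ext y
      by_cases hy : y ∈ B <;> simp [hf₁, hy]
    rw [e, lintegral_indicator measurableSet_ball]
    refine (lintegral_ball_le_maximalFn _ (ball_subset_ball (by linarith) hx₁)).trans ?_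
    have := volume_ball_mul x x hr.le 100
    norm_num at this
    rw [this]
    gcongr
  have hT₁2 : ∫⁻ y, T₁ y ^ (2 : ℝ) ≤ A * 100 ^ d * volume (ball x r) * (γ * l) ^ (2 : ℝ) := by
    have hmem : MemLp f₁ 2 volume := by
      refine ⟨hf₁m, ?_⟩
      rw [eLpNorm_lt_top_iff_lintegral_rpow_enorm_lt_top (by simp) (by simp)]
      refine lt_of_le_of_lt (by simpa using hf₁2) ?_
      have := volume_ball_ne_top x r
      finiteness
    refine (hK.l2_bound f₁ hmem).trans ?_
    simp only [mul_assoc] at hf₁2 ⊢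
    gcongr
  have hFle : ∀ y, F y ≤ T₁ y + ‖T₂ y‖ₑ := fun y => by
    simp only [hF, hT₁, hT₂, hf₁]
    rw [convOp_indicator_add hK.continuous hK.bound hf hMft (S := B) measurableSet_ball y]
    exact enorm_add_le _ _
  have hT₂le : ∀ y, ‖T₂ y‖ₑ ≤ T₁ y + F y := fun y => by
    simp only [hF, hT₁, hT₂, hf₁]
    rw [convOp_indicator_add hK.continuous hK.bound hf hMft (S := B) measurableSet_ball y, add_comm]
    refine (enorm_sub_le (E := ℂ)).trans' (le_of_eq ?_)
    congr 1
    ring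
  set Q := ball x (16 * r) with hQ
  have hQ0 : volume Q ≠ 0 := volume_ball_ne_zero x (by positivity)
  have hQt : volume Q ≠ ∞ := volume_ball_ne_top _ _
  have hrQ : volume (ball x r) ≤ volume Q := measure_mono (ball_subset_ball (by linarith))
  -- After multiplication by `l`, the bound `l T₁ ≤ l² + T₁²` reduces the average to the `L²`
  -- estimate.
  have hT₁Q : ∫⁻ y in Q, T₁ y ≤ volume Q * (((1 + A * 100 ^ d : ℝ≥0) : ℝ≥0∞) * l) := by
    rw [← ENNReal.mul_le_mul_iff_right hl0 ENNReal.coe_ne_top,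
      ← lintegral_const_mul' _ _ ENNReal.coe_ne_top]
    calc ∫⁻ y in Q, l * T₁ y ≤ ∫⁻ y in Q, ((l : ℝ≥0∞) ^ (2 : ℝ) + T₁ y ^ (2 : ℝ)) :=
          lintegral_mono fun y => mul_le_sq_add_sq _ _
      _ ≤ (l : ℝ≥0∞) ^ (2 : ℝ) * volume Q + ∫⁻ y, T₁ y ^ (2 : ℝ) := by
          rw [lintegral_add_left measurable_const, setLIntegral_const]
          gcongr
          exact Measure.restrict_le_self
      _ ≤ (l : ℝ≥0∞) ^ (2 : ℝ) * volume Q +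
          A * 100 ^ d * volume Q * (1 * l) ^ (2 : ℝ) := by
          gcongr
          refine hT₁2.trans ?_
          gcongr
          exact_mod_cast hγ
      _ = _ := by
          push_cast
          rw [one_mul, ENNReal.rpow_two]
          ring
  -- A pointwise bound is obtained by averaging `‖T₂ y‖ ≤ ‖T₂ y - T₂ y'‖ + T₁ y' + F y'` over `y'`
  -- in `Q`.
  have hT₂Q : ∀ y ∈ Q, ‖T₂ y‖ₑ ≤ c₀ * l := fun y hy => by
    rw [← ENNReal.mul_le_mul_iff_right hQ0 hQt]
    calc volume Q * ‖T₂ y‖ₑ = ∫⁻ y' in Q, ‖T₂ y‖ₑ := by rw [setLIntegral_const, mul_comm]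
      _ ≤ ∫⁻ y' in Q, (c₁ * l + (T₁ y' + F y')) := by
          refine setLIntegral_mono' measurableSet_ball fun y' hy' => ?_
          have h1 := hc₁ K hK f hf x x₁ r hr hx₁ hMft y hy y' hy'
          calc ‖T₂ y‖ₑ = ‖(T₂ y - T₂ y') + T₂ y'‖ₑ := by rw [sub_add_cancel]
            _ ≤ ‖T₂ y - T₂ y'‖ₑ + ‖T₂ y'‖ₑ := enorm_add_le _ _
            _ ≤ _ := by
              gcongr
              · refine h1.trans ?_
                gcongr
                refine hMf.trans ?_
                exact mul_le_of_le_one_left' (by exact_mod_cast hγ)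
              · exact hT₂le y'
      _ = c₁ * l * volume Q + ((∫⁻ y' in Q, T₁ y') + ∫⁻ y' in Q, F y') := by
          rw [lintegral_add_left measurable_const, setLIntegral_const,
            lintegral_add_left' hT₁m.restrict]
      _ ≤ c₁ * l * volume Q +
          (volume Q * (((1 + A * 100 ^ d : ℝ≥0) : ℝ≥0∞) * l) + volume Q * l) := by
          gcongr
          have hzQ : z ∈ Q := by rw [hQ, mem_ball, dist_comm]; linarith
          refine (lintegral_ball_le_maximalFn F hzQ).trans ?_
          gcongr
      _ = _ := by
          rw [hc₀]; push_cast; ring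
  have hsub : {y | ↑(5 ^ d + c₀ + 1) * (l : ℝ≥0∞) < maximalFn F y ∧
      maximalFn (fun y => ‖f y‖ₑ ^ (2 : ℝ)) y ≤ (γ * l) ^ (2 : ℝ)} ∩ ball x (5 * r) ⊆
      {y | (l : ℝ≥0∞) ^ (2 : ℝ) ≤ maximalFn T₁ y ^ (2 : ℝ)} := by
    rintro y ⟨⟨hy, -⟩, hyx⟩
    obtain ⟨c, s, hyc, hlt⟩ := lt_maximalFn_iff.1 hy
    have hs : 0 < s := pos_of_mem_ball hyc
    refine ENNReal.rpow_le_rpow (lt_maximalFn_iff.2 ⟨c, s, hyc, ?_⟩).le zero_le_two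
    rw [mem_ball] at hyx hyc
    -- A large ball has a fivefold dilate containing `z`, so its average of `F` is at most `5 ^ d *
    -- l`, a contradiction. A small ball lies in `Q`, where the far part is under control, so the
    -- average of `T₁` exceeds `l`.
    rcases lt_or_ge (5 * r) s with hsr | hsr
    · exfalso
      have hzc : z ∈ ball c (5 * s) := by
        rw [mem_ball]
        have h1 := dist_triangle z x c
        have h2 := dist_triangle x y c
        rw [dist_comm x y] at h2
        rw [dist_comm z x] at h1
        linarith
      have h3 : ∫⁻ y in ball c s, F y ≤ 5 ^ d * l * volume (ball c s) := by
        refine (lintegral_mono_set (ball_subset_ball (by linarith))).trans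
          ((lintegral_ball_le_maximalFn F hzc).trans ?_)
        have := volume_ball_mul c c hs.le 5
        norm_num at this
        rw [this, mul_right_comm]
        gcongr
      have h4 : (5 : ℝ≥0∞) ^ d * l * volume (ball c s) ≤
          ↑(5 ^ d + c₀ + 1) * (l : ℝ≥0∞) * volume (ball c s) := by
        gcongr
        push_cast
        rw [add_assoc]
        exact le_self_add
      exact absurd (hlt.trans_le h3) (not_lt.2 h4)
    · have hDQ : ball c s ⊆ Q := ball_subset_ball' (by
        have := dist_triangle c y x
        rw [dist_comm c y] at this
        linarith)
      have h5 : ∫⁻ y in ball c s, F y ≤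
          (∫⁻ y in ball c s, T₁ y) + c₀ * l * volume (ball c s) := by
        rw [← setLIntegral_const, ← lintegral_add_left' hT₁m.restrict]
        refine setLIntegral_mono' measurableSet_ball fun y hy => (hFle y).trans ?_
        gcongr
        exact hT₂Q y (hDQ hy)
      have h6 : l * volume (ball c s) + c₀ * l * volume (ball c s) ≤
          ↑(5 ^ d + c₀ + 1) * (l : ℝ≥0∞) * volume (ball c s) := by
        rw [← add_mul, ← one_add_mul]
        gcongr
        push_cast
        rw [add_comm, add_assoc]
        exact le_add_self
      refine lt_of_add_lt_add_right ((h6.trans_lt hlt).trans_le h5)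
  refine (measure_mono hsub).trans ?_
  have hl2 : (l : ℝ≥0∞) ^ (2 : ℝ) ≠ 0 := by simpa using hl.ne'
  have hl2t : (l : ℝ≥0∞) ^ (2 : ℝ) ≠ ∞ := by finiteness
  rw [← ENNReal.mul_le_mul_iff_right hl2 hl2t]
  refine (mul_meas_ge_le_lintegral ((measurable_maximalFn T₁).pow_const 2) _).trans ?_
  refine (hC₂ T₁ hT₁m).trans ((mul_le_mul_right hT₁2 _).trans_eq ?_)
  rw [ENNReal.mul_rpow_of_nonneg _ _ zero_le_two]
  push_cast
  ring

end CalderonZygmund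

/-! ### `L^q` bounds for Calderón–Zygmund kernels -/

section CalderonZygmundLp

open Metric Set Module

variable {E : Type*} [NormedAddCommGroup E] [InnerProductSpace ℝ E] [FiniteDimensional ℝ E]
  [MeasurableSpace E] [BorelSpace E]

/-- The good-`λ` inequality for a Calderón–Zygmund kernel. -/
theorem exists_good_lambda (E : Type*) [NormedAddCommGroup E] [InnerProductSpace ℝ E]
    [FiniteDimensional ℝ E] [MeasurableSpace E] [BorelSpace E] [Nontrivial E] (A : ℝ≥0) :
    ∃ A₀ D : ℝ≥0, 1 ≤ A₀ ∧ ∀ K : E → ℂ, IsCZKernel A K →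
      ∀ f : E → ℂ, AEStronglyMeasurable f volume →
      ∀ (l γ : ℝ≥0), 0 < l → γ ≤ 1 →
      volume {y | (l : ℝ≥0∞) < maximalFn (fun y => ‖convOp K f y‖ₑ) y} ≠ ∞ →
      volume {y | A₀ * l < maximalFn (fun y => ‖convOp K f y‖ₑ) y ∧
        maximalFn (fun y => ‖f y‖ₑ ^ (2 : ℝ)) y ≤ (γ * l) ^ (2 : ℝ)} ≤
      D * γ ^ (2 : ℝ) * volume {y | (l : ℝ≥0∞) < maximalFn (fun y => ‖convOp K f y‖ₑ) y} := by
  obtain ⟨A₀, D, hA₀, h⟩ := exists_good_lambda_local E A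
  refine ⟨A₀, D, hA₀, fun K hK f hf l γ hl hγ hfin => ?_⟩
  set u := maximalFn (fun y => ‖convOp K f y‖ₑ) with hu
  set Ω := {y | (l : ℝ≥0∞) < u y} with hΩ
  set s := {y | A₀ * l < u y ∧
        maximalFn (fun y => ‖f y‖ₑ ^ (2 : ℝ)) y ≤ (γ * l) ^ (2 : ℝ)} with hs
  have hΩo : IsOpen Ω := isOpen_lt_maximalFn _ _
  have hΩc : IsClosed Ωᶜ := hΩo.isClosed_compl
  have hne : Ωᶜ.Nonempty := by
    rw [nonempty_compl]
    intro h1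
    rw [h1, measure_univ_of_isAddLeftInvariant] at hfin
    exact hfin rfl
  have hsΩ : s ⊆ Ω := fun y hy => by
    refine lt_of_le_of_lt ?_ hy.1
    exact le_mul_of_one_le_left' (by exact_mod_cast hA₀)
  -- A Whitney-type radius: the ball stays in `Ω`, and a nearest point of `Ωᶜ`, at distance `10 * r
  -- x`, plays the role of `z` in the local estimate.
  set r : E → ℝ := fun x => infDist x Ωᶜ / 10 with hr
  have hrpos : ∀ x ∈ Ω, 0 < r x := fun x hx => by
    have := (hΩc.notMem_iff_infDist_pos hne).1 (not_not.2 hx : x ∉ Ωᶜ)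
    simp only [hr]; positivity
  have hball : ∀ x ∈ Ω, ball x (r x) ⊆ Ω := fun x hx y hy => by
    by_contra hyΩ
    have h1 := infDist_le_dist_of_mem (x := x) (show y ∈ Ωᶜ from hyΩ)
    rw [mem_ball, dist_comm] at hy
    have h2 := hrpos x hx
    simp only [hr] at hy h2
    linarith
  obtain ⟨R, hR⟩ := exists_radius_bound (E := E) hfin
  have key := volume_le_of_vitali (((D : ℝ≥0∞) * γ ^ (2 : ℝ)) • volume.restrict Ω) s id r R
    (fun x hx => hR x _ (measure_mono (hball x (hsΩ hx))))
    (fun x hx => mem_ball_self (hrpos x (hsΩ hx))) fun x hx => ?_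
  · simpa using key
  · obtain ⟨z, hz, hxz⟩ := hΩc.exists_infDist_eq_dist hne x
    rw [Measure.smul_apply, Measure.restrict_apply measurableSet_ball, smul_eq_mul, id,
      inter_eq_left.2 (hball x (hsΩ hx))]
    refine h K hK f hf l γ x z (r x) hl hγ (hrpos x (hsΩ hx)) ?_ (not_lt.1 hz)
    simp only [hr]
    linarith

/-- The constant depends on the bound for the individual kernel. This serves only to know that
certain norms are finite, or to control an error that tends to zero. -/
theorem exists_convOp_lp_of_bound (E : Type*) [NormedAddCommGroup E] [InnerProductSpace ℝ E]
    [FiniteDimensional ℝ E] [MeasurableSpace E] [BorelSpace E] [Nontrivial E] {q : ℝ}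
    (hq : 1 < q) {K : E → ℂ} (hK : ∃ B : ℝ≥0, ∀ x, ‖K x‖ ≤ B * poissonMaj 1 x) :
    ∃ C : ℝ≥0, ∀ f : E → ℂ, AEStronglyMeasurable f volume →
      ∫⁻ x, ‖convOp K f x‖ₑ ^ q ≤ C * ∫⁻ x, ‖f x‖ₑ ^ q := by
  obtain ⟨C, hC⟩ := exists_enorm_convOp_le E
  obtain ⟨C₁, hC₁⟩ := strong_type_maximalFn E hq
  obtain ⟨B, hB⟩ := hK
  have hq0 : 0 ≤ q := by linarith
  refine ⟨(B * C) ^ q * C₁, fun f hf => ?_⟩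
  calc ∫⁻ x, ‖convOp K f x‖ₑ ^ q
      ≤ ∫⁻ x, (B * C : ℝ≥0∞) ^ q * maximalFn (fun y => ‖f y‖ₑ) x ^ q := by
        refine lintegral_mono fun x => ?_
        rw [← ENNReal.mul_rpow_of_nonneg _ _ hq0]
        gcongr
        exact hC 1 B K f one_pos hf hB x
    _ ≤ (B * C : ℝ≥0∞) ^ q * (C₁ * ∫⁻ x, ‖f x‖ₑ ^ q) := by
        rw [lintegral_const_mul' _ _ (by finiteness)]
        gcongr
        exact hC₁ _ hf.enorm
    _ = _ := by
        push_cast [ENNReal.coe_rpow_of_nonneg _ hq0]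
        ring

theorem lintegral_convOp_rpow_ne_top [Nontrivial E] {q : ℝ} (hq : 1 < q) {K f : E → ℂ}
    (hK : ∃ B : ℝ≥0, ∀ x, ‖K x‖ ≤ B * poissonMaj 1 x)
    (hf : AEStronglyMeasurable f volume) (h : ∫⁻ x, ‖f x‖ₑ ^ q ≠ ∞) :
    ∫⁻ x, ‖convOp K f x‖ₑ ^ q ≠ ∞ := by
  obtain ⟨C, hC⟩ := exists_convOp_lp_of_bound E hq hK
  exact ((hC f hf).trans_lt (by finiteness)).ne

/-- The good-`λ` inequality is integrated against `t ^ (q - 1)`. For small `γ` the term with `u` is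
absorbed, and what remains is the `L^q` norm of `M(|f|²)^{1/2}`, bounded by the maximal theorem
because `q / 2 > 1`. -/
theorem exists_convOp_lp_of_two_lt (E : Type*) [NormedAddCommGroup E] [InnerProductSpace ℝ E]
    [FiniteDimensional ℝ E] [MeasurableSpace E] [BorelSpace E] [Nontrivial E] (A : ℝ≥0) {q : ℝ}
    (hq : 2 < q) :
    ∃ C : ℝ≥0, ∀ K : E → ℂ, IsCZKernel A K → ∀ f : E → ℂ, AEStronglyMeasurable f volume →
      ∫⁻ x, ‖f x‖ₑ ^ q ≠ ∞ → ∫⁻ x, ‖convOp K f x‖ₑ ^ q ≤ C * ∫⁻ x, ‖f x‖ₑ ^ q := by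
  obtain ⟨A₀, D, hA₀, hgl⟩ := exists_good_lambda E A
  obtain ⟨C₁, hC₁⟩ := strong_type_maximalFn E (q := q) (by linarith)
  obtain ⟨C₂, hC₂⟩ := strong_type_maximalFn E (q := q / 2) (by linarith)
  have hq0 : 0 < q := by linarith
  -- Chosen so that `γ = b ^ (-1/2)` satisfies `A₀ ^ q * D * γ² ≤ 1/2`.
  set b : ℝ≥0 := 2 * A₀ ^ q * D + 1 with hb
  have hb1 : 1 ≤ b := le_add_self
  set γ : ℝ≥0 := b ^ (-(1 / 2) : ℝ) with hγ
  have hγpos : 0 < γ := NNReal.rpow_pos (by positivity)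
  have hγ1 : γ ≤ 1 := NNReal.rpow_le_one_of_one_le_of_nonpos hb1 (by norm_num)
  have hγ2 : γ ^ (2 : ℝ) = b⁻¹ := by
    rw [hγ, ← NNReal.rpow_mul]
    norm_num
    exact NNReal.rpow_neg_one b
  have hA₀pos : 0 < A₀ := one_pos.trans_le hA₀
  refine ⟨2 * A₀ ^ q * ((γ⁻¹) ^ q * C₂), fun K hK f hf hfin => ?_⟩
  set u := maximalFn (fun y => ‖convOp K f y‖ₑ) with hu
  set W := maximalFn (fun y => ‖f y‖ₑ ^ (2 : ℝ)) with hW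
  have hum : Measurable u := measurable_maximalFn _
  have hWm : Measurable W := measurable_maximalFn _
  have hTm := aestronglyMeasurable_convOp hK.continuous hf
  have hTfin : ∫⁻ x, ‖convOp K f x‖ₑ ^ q ≠ ∞ :=
    lintegral_convOp_rpow_ne_top (by linarith) hK.bound hf hfin
  have hX : ∫⁻ x, u x ^ q ≠ ∞ := ((hC₁ _ hTm.enorm).trans_lt (by finiteness)).ne
  have hlev : ∀ l : ℝ≥0, 0 < l → volume {y | (l : ℝ≥0∞) < u y} ≠ ∞ := fun l hl => by
    have h1 := mul_meas_ge_le_lintegral (μ := volume) (hum.pow_const q) ((l : ℝ≥0∞) ^ q)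
    have hl0 : (l : ℝ≥0∞) ^ q ≠ 0 := by
      simp [hl.ne']
    intro htop
    have h2 : volume {y | (l : ℝ≥0∞) ^ q ≤ u y ^ q} = ∞ := by
      rw [← top_le_iff, ← htop]
      refine measure_mono fun y hy => ENNReal.rpow_le_rpow (le_of_lt hy) hq0.le
    rw [h2, ENNReal.mul_top hl0, top_le_iff] at h1
    exact hX h1
  have hpt : ∀ t : ℝ, 0 < t → volume {y | ENNReal.ofReal t < (A₀ : ℝ≥0∞)⁻¹ * u y} ≤
      D * γ ^ (2 : ℝ) * volume {y | ENNReal.ofReal t < u y} +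
        volume {y | ENNReal.ofReal t < (γ : ℝ≥0∞)⁻¹ * W y ^ (2⁻¹ : ℝ)} := fun t ht => by
    have h1 := hgl K hK f hf t.toNNReal γ (Real.toNNReal_pos.2 ht) hγ1
      (hlev _ (Real.toNNReal_pos.2 ht))
    refine le_trans (measure_mono fun y hy => ?_)
      ((measure_union_le _ _).trans (add_le_add_left h1 _))
    rw [mem_ofPred_eq, mul_comm, ← div_eq_mul_inv, ENNReal.lt_div_iff_mul_lt (.inl (by
      exact_mod_cast hA₀pos.ne')) (.inl ENNReal.coe_ne_top), mul_comm] at hy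
    rw [mem_union]
    by_cases hw : W y ≤ (γ * ENNReal.ofReal t) ^ (2 : ℝ)
    · exact .inl ⟨hy, hw⟩
    · refine .inr ?_
      rw [mem_ofPred_eq, mul_comm, ← div_eq_mul_inv, ENNReal.lt_div_iff_mul_lt (.inl (by
        exact_mod_cast hγpos.ne')) (.inl ENNReal.coe_ne_top), mul_comm,
        ENNReal.lt_rpow_inv_iff two_pos]
      exact not_le.1 hw
  have hmain : (∫⁻ x, u x ^ q) ≤ A₀ ^ q * (D * γ ^ (2 : ℝ) * ∫⁻ x, u x ^ q) +
      A₀ ^ q * ((γ⁻¹ : ℝ≥0) ^ q * (C₂ * ∫⁻ x, ‖f x‖ₑ ^ q)) := by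
    have e1 : ∫⁻ x, u x ^ q = A₀ ^ q * ∫⁻ x, ((A₀ : ℝ≥0∞)⁻¹ * u x) ^ q := by
      rw [← lintegral_const_mul' _ _ (by finiteness)]
      refine lintegral_congr fun x => ?_
      rw [← ENNReal.mul_rpow_of_nonneg _ _ hq0.le, ← mul_assoc, ENNReal.mul_inv_cancel
        (by exact_mod_cast hA₀pos.ne') ENNReal.coe_ne_top, one_mul]
    have e2 : ∫⁻ x, ((γ : ℝ≥0∞)⁻¹ * W x ^ (2⁻¹ : ℝ)) ^ q ≤
        (γ⁻¹ : ℝ≥0) ^ q * (C₂ * ∫⁻ x, ‖f x‖ₑ ^ q) := by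
      have h3 := hC₂ _ (hf.enorm.pow_const (2 : ℝ))
      simp only [← ENNReal.rpow_mul] at h3
      rw [mul_div_cancel₀ _ (two_ne_zero' ℝ)] at h3
      refine le_trans (le_of_eq ?_) (mul_le_mul_right h3 _)
      rw [← lintegral_const_mul' _ _ (by finiteness)]
      refine lintegral_congr fun x => ?_
      rw [ENNReal.mul_rpow_of_nonneg _ _ hq0.le, ← ENNReal.rpow_mul,
        ENNReal.coe_inv hγpos.ne', inv_mul_eq_div]
    conv_lhs => rw [e1]
    rw [← mul_add]
    gcongr
    refine le_trans ?_ (add_le_add_right e2 _)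
    have hm2 : Measurable fun x => (γ : ℝ≥0∞)⁻¹ * W x ^ (2⁻¹ : ℝ) := by fun_prop
    rw [lintegral_rpow_eq_layercake _ hq0 (hum.const_mul _),
      lintegral_rpow_eq_layercake _ hq0 hum, lintegral_rpow_eq_layercake _ hq0 hm2,
      mul_left_comm _ (ENNReal.ofReal q), ← mul_add]
    gcongr
    have hme : Measurable fun t : ℝ => D * (γ : ℝ≥0∞) ^ (2 : ℝ) *
        (ENNReal.ofReal (t ^ (q - 1)) * volume {x | ENNReal.ofReal t < u x}) := by
      have : Antitone fun t : ℝ => volume {x | ENNReal.ofReal t < u x} := fun s t hst =>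
        measure_mono fun x hx => (ENNReal.ofReal_le_ofReal hst).trans_lt hx
      have := this.measurable
      fun_prop
    rw [← lintegral_const_mul' _ _ (by finiteness), ← lintegral_add_left hme]
    refine setLIntegral_mono' measurableSet_Ioi fun t ht => ?_
    refine (mul_le_mul_right (hpt t ht) _).trans_eq ?_
    ring
  have hhalf : (A₀ : ℝ≥0∞) ^ q * (D * γ ^ (2 : ℝ) * ∫⁻ x, u x ^ q) ≤
      2⁻¹ * ∫⁻ x, u x ^ q := by
    rw [← mul_assoc]
    gcongr
    have : A₀ ^ q * (D * γ ^ (2 : ℝ)) ≤ 2⁻¹ := by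
      rw [hγ2, ← mul_assoc, ← div_eq_mul_inv, div_le_iff₀ (by positivity), hb, mul_add,
        mul_assoc 2, ← mul_assoc 2⁻¹, inv_mul_cancel₀ two_ne_zero, one_mul]
      exact le_self_add
    rw [← ENNReal.coe_rpow_of_nonneg _ hq0.le, ← ENNReal.coe_rpow_of_nonneg _ zero_le_two]
    rw [show (2⁻¹ : ℝ≥0∞) = ((2⁻¹ : ℝ≥0) : ℝ≥0∞) by simp]
    exact_mod_cast this
  have hfinal : (∫⁻ x, u x ^ q) ≤ ↑(2 * A₀ ^ q * ((γ⁻¹) ^ q * C₂)) * ∫⁻ x, ‖f x‖ₑ ^ q := by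
    set X := ∫⁻ x, u x ^ q with hXdef
    have h5 : X ≤ 2⁻¹ * X + A₀ ^ q * ((γ⁻¹ : ℝ≥0) ^ q * (C₂ * ∫⁻ x, ‖f x‖ₑ ^ q)) :=
      hmain.trans (add_le_add_left hhalf _)
    have h6 : 2⁻¹ * X ≤ A₀ ^ q * ((γ⁻¹ : ℝ≥0) ^ q * (C₂ * ∫⁻ x, ‖f x‖ₑ ^ q)) := by
      have h7 : X = 2⁻¹ * X + 2⁻¹ * X := by
        rw [← add_mul, ENNReal.inv_two_add_inv_two, one_mul]
      have h5 : 2⁻¹ * X + 2⁻¹ * X ≤ 2⁻¹ * X + _ := h7.symm.trans_le h5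
      -- Absorption is legitimate because `X` is finite by the qualitative bound.
      exact (ENNReal.add_le_add_iff_left (by finiteness)).1 h5
    calc X = 2 * (2⁻¹ * X) := by
          rw [← mul_assoc, ENNReal.mul_inv_cancel (by simp) (by simp), one_mul]
      _ ≤ 2 * (A₀ ^ q * ((γ⁻¹ : ℝ≥0) ^ q * (C₂ * ∫⁻ x, ‖f x‖ₑ ^ q))) := by gcongr
      _ = _ := by
          push_cast [ENNReal.coe_rpow_of_nonneg _ hq0.le]
          ring
  refine le_trans (lintegral_mono_ae ?_) hfinal
  have hloc : LocallyIntegrable (convOp K f) volume := by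
    have : MemLp (convOp K f) (ENNReal.ofReal q) volume := by
      refine ⟨hTm, ?_⟩
      rw [eLpNorm_lt_top_iff_lintegral_rpow_enorm_lt_top (by simpa using hq0) (by simp),
        ENNReal.toReal_ofReal hq0.le]
      exact hTfin.lt_top
    exact this.locallyIntegrable (by
      rw [← ENNReal.ofReal_one]; exact ENNReal.ofReal_le_ofReal (by linarith))
  filter_upwards [enorm_le_maximalFn_ae hloc] with x hx
  gcongr

/-- The transpose is the original operator conjugated by `x ↦ -x`, so bounds for `K` transfer to it
without checking that the reflected kernel is Calderón–Zygmund. -/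
theorem convOp_comp_neg (K g : E → ℂ) (y : E) :
    convOp (fun z => K (-z)) g y = convOp K (fun z => g (-z)) (-y) := by
  rw [convOp, convOp, ← integral_neg_eq_self]
  refine integral_congr_ae (.of_forall fun x => ?_)
  simp only [sub_neg_eq_add, neg_add_rev]
  congr 2
  abel

/-- The bilinear form of a convolution operator and of its transpose agree. -/
theorem integral_convOp_mul [Nontrivial E] {q q' : ℝ} (hqq : q.HolderConjugate q') {K f g : E → ℂ}
    (hc : Continuous K) (hK : ∃ B : ℝ≥0, ∀ x, ‖K x‖ ≤ B * poissonMaj 1 x)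
    (hf : AEStronglyMeasurable f volume) (hfin : ∫⁻ x, ‖f x‖ₑ ^ q ≠ ∞)
    (hg : AEStronglyMeasurable g volume) (hgin : ∫⁻ x, ‖g x‖ₑ ^ q' ≠ ∞) :
    ∫ x, convOp K f x * g x = ∫ y, f y * convOp (fun z => K (-z)) g y := by
  have hmeas : AEStronglyMeasurable (fun z : E × E => K (z.1 - z.2) * f z.2 * g z.1)
      (volume.prod volume) :=
    ((hc.comp (continuous_fst.sub continuous_snd)).aestronglyMeasurable.mul hf.comp_snd).mul
      hg.comp_fst
  have hint : Integrable (fun z : E × E => K (z.1 - z.2) * f z.2 * g z.1)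
      (volume.prod volume) := by
    refine ⟨hmeas, ?_⟩
    rw [hasFiniteIntegral_iff_enorm, lintegral_prod _ hmeas.enorm]
    obtain ⟨C, hC⟩ := exists_lintegral_poissonMaj_le E
    obtain ⟨C₁, hC₁⟩ := strong_type_maximalFn E hqq.lt
    obtain ⟨B, hB⟩ := hK
    set m := maximalFn (fun y => ‖f y‖ₑ) with hm
    have hmm : Measurable m := measurable_maximalFn _
    calc ∫⁻ x, ∫⁻ y, ‖K (x - y) * f y * g x‖ₑ
        ≤ ∫⁻ x, (B * C : ℝ≥0∞) * (m * fun x => ‖g x‖ₑ) x := by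
          refine lintegral_mono fun x => ?_
          calc ∫⁻ y, ‖K (x - y) * f y * g x‖ₑ
              ≤ ∫⁻ y, (B * ‖g x‖ₑ) * (ENNReal.ofReal (poissonMaj 1 (x - y)) * ‖f y‖ₑ) := by
                refine lintegral_mono fun y => ?_
                rw [enorm_mul, enorm_mul, ← ENNReal.ofReal_coe_nnreal, ← ofReal_norm (K _)]
                have : ENNReal.ofReal ‖K (x - y)‖ ≤
                    ENNReal.ofReal B * ENNReal.ofReal (poissonMaj 1 (x - y)) := by
                  rw [← ENNReal.ofReal_mul (by positivity)]
                  exact ENNReal.ofReal_le_ofReal (hB _)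
                calc _ ≤ ENNReal.ofReal B * ENNReal.ofReal (poissonMaj 1 (x - y)) *
                    ‖f y‖ₑ * ‖g x‖ₑ := by gcongr
                  _ = _ := by ring
            _ ≤ (B * ‖g x‖ₑ) * (C * m x) := by
                rw [lintegral_const_mul' _ _ (by finiteness)]
                gcongr
                exact hC 1 one_pos _ hf.enorm x
            _ = _ := by simp only [Pi.mul_apply]; ring
      _ ≤ (B * C : ℝ≥0∞) *
          ((∫⁻ x, m x ^ q) ^ (1 / q) * (∫⁻ x, ‖g x‖ₑ ^ q') ^ (1 / q')) := by
          rw [lintegral_const_mul' _ _ (by finiteness)]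
          gcongr
          exact ENNReal.lintegral_mul_le_Lp_mul_Lq _ hqq hmm.aemeasurable hg.enorm
      _ < ∞ := by
          have h1 : ∫⁻ x, m x ^ q ≠ ∞ := ((hC₁ _ hf.enorm).trans_lt (by finiteness)).ne
          have h2 : 0 ≤ 1 / q := one_div_nonneg.2 hqq.nonneg
          have h3 : 0 ≤ 1 / q' := one_div_nonneg.2 hqq.symm.nonneg
          finiteness
  calc ∫ x, convOp K f x * g x = ∫ x, ∫ y, K (x - y) * f y * g x := by
        refine integral_congr_ae (.of_forall fun x => ?_)
        simp only [convOp]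
        rw [integral_mul_const]
    _ = ∫ y, ∫ x, K (x - y) * f y * g x := integral_integral_swap hint
    _ = _ := by
        refine integral_congr_ae (.of_forall fun y => ?_)
        simp only [convOp]
        rw [← integral_const_mul]
        refine integral_congr_ae (.of_forall fun x => ?_)
        simp only [neg_sub]
        ring

/-- Duality: the transpose is bounded on `L^{q'}` with `q' > 2`. Testing against the extremal `g`
gives `X ≤ ‖f‖_q (C X)^{1/q'}`, and the finite power of `X` is divided out. -/
theorem exists_convOp_lp_of_lt_two (E : Type*) [NormedAddCommGroup E] [InnerProductSpace ℝ E]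
    [FiniteDimensional ℝ E] [MeasurableSpace E] [BorelSpace E] [Nontrivial E] (A : ℝ≥0) {q : ℝ}
    (hq1 : 1 < q) (hq : q < 2) :
    ∃ C : ℝ≥0, ∀ K : E → ℂ, IsCZKernel A K → ∀ f : E → ℂ, AEStronglyMeasurable f volume →
      ∫⁻ x, ‖f x‖ₑ ^ q ≠ ∞ → ∫⁻ x, ‖convOp K f x‖ₑ ^ q ≤ C * ∫⁻ x, ‖f x‖ₑ ^ q := by
  have hqq : q.HolderConjugate (q / (q - 1)) := Real.HolderConjugate.conjExponent hq1
  set q' := q / (q - 1) with hq'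
  have hq0 : 0 < q := by linarith
  have hq'0 : 0 < q' := hqq.symm.pos
  have hq'2 : 2 < q' := by
    rw [hq', lt_div_iff₀ (by linarith)]; linarith
  obtain ⟨C, hC⟩ := exists_convOp_lp_of_two_lt E A hq'2
  refine ⟨(C ^ (1 / q')) ^ q, fun K hK f hf hfin => ?_⟩
  have hTm := aestronglyMeasurable_convOp hK.continuous hf
  set T := convOp K f with hT
  have hX : ∫⁻ x, ‖T x‖ₑ ^ q ≠ ∞ :=
    lintegral_convOp_rpow_ne_top hq1 hK.bound hf hfin
  set X := ∫⁻ x, ‖T x‖ₑ ^ q with hXdef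
  -- The Hölder extremizer: `T * g = |T| ^ q` and `|g| ^ q' = |T| ^ q`.
  set g : E → ℂ := fun x => ((‖T x‖ ^ (q - 2) : ℝ) : ℂ) * (starRingEnd ℂ) (T x) with hg
  have hgm : AEStronglyMeasurable g volume := by
    refine AEStronglyMeasurable.mul ?_ (Complex.continuous_conj.comp_aestronglyMeasurable hTm)
    exact Complex.continuous_ofReal.comp_aestronglyMeasurable
      (hTm.norm.aemeasurable.pow_const _).aestronglyMeasurable
  have hgnorm : ∀ x, ‖g x‖ = ‖T x‖ ^ (q - 1) := fun x => by
    rw [hg]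
    simp only [norm_mul, Complex.norm_real, RCLike.norm_conj]
    rw [Real.norm_of_nonneg (Real.rpow_nonneg (norm_nonneg _) _)]
    rcases eq_or_lt_of_le (norm_nonneg (T x)) with h0 | h0
    · rw [← h0, mul_zero, Real.zero_rpow (by linarith)]
    · nth_rewrite 2 [← Real.rpow_one ‖T x‖]
      rw [← Real.rpow_add h0]
      congr 1; ring
  have hgq : ∀ x, ‖g x‖ₑ ^ q' = ‖T x‖ₑ ^ q := fun x => by
    rw [← ofReal_norm, ← ofReal_norm, hgnorm,
      ← ENNReal.ofReal_rpow_of_nonneg (norm_nonneg _) (by linarith), ← ENNReal.rpow_mul]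
    congr 1
    rw [hq', mul_div_cancel₀ _ (by linarith)]
  have hgT : ∀ x, T x * g x = ((‖T x‖ ^ q : ℝ) : ℂ) := fun x => by
    simp only [hg]
    rw [mul_left_comm, Complex.mul_conj, ← Complex.ofReal_mul, Complex.normSq_eq_norm_sq]
    congr 1
    rcases eq_or_lt_of_le (norm_nonneg (T x)) with h0 | h0
    · rw [← h0, Real.zero_rpow hq0.ne']; simp
    · rw [← Real.rpow_two, ← Real.rpow_add h0]
      congr 1; ring
  have hgX : ∫⁻ x, ‖g x‖ₑ ^ q' = X := lintegral_congr hgq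
  have hTint : Integrable (fun x => ‖T x‖ ^ q) volume := by
    refine ⟨(hTm.norm.aemeasurable.pow_const _).aestronglyMeasurable, ?_⟩
    rw [hasFiniteIntegral_iff_enorm]
    refine lt_of_eq_of_lt (lintegral_congr fun x => ?_) hX.lt_top
    rw [← ofReal_norm, Real.norm_of_nonneg (Real.rpow_nonneg (norm_nonneg _) _),
      ← ENNReal.ofReal_rpow_of_nonneg (norm_nonneg _) hq0.le, ofReal_norm]
  have hXeq : X = ‖∫ x, T x * g x‖ₑ := by
    simp only [hgT]
    rw [integral_complex_ofReal, ← ofReal_norm, Complex.norm_real,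
      Real.norm_of_nonneg (integral_nonneg fun x => Real.rpow_nonneg (norm_nonneg _) _),
      ofReal_integral_eq_lintegral_ofReal hTint
        (.of_forall fun x => Real.rpow_nonneg (norm_nonneg _) _)]
    refine lintegral_congr fun x => ?_
    rw [← ENNReal.ofReal_rpow_of_nonneg (norm_nonneg _) hq0.le, ofReal_norm]
  have hKn : Continuous fun z => K (-z) := hK.continuous.comp continuous_neg
  have hTt : ∫⁻ y, ‖convOp (fun z => K (-z)) g y‖ₑ ^ q' ≤ C * X := by
    have hgn : AEStronglyMeasurable (fun z => g (-z)) volume :=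
      hgm.comp_measurePreserving (Measure.measurePreserving_neg volume)
    have e : ∫⁻ x, ‖g (-x)‖ₑ ^ q' = X := by
      rw [← hgX]; exact lintegral_neg_eq_self (fun x => ‖g x‖ₑ ^ q')
    have := hC K hK (fun z => g (-z)) hgn (by rw [e]; exact hX)
    rw [e] at this
    refine le_trans (le_of_eq ?_) this
    simp only [convOp_comp_neg]
    exact lintegral_neg_eq_self (fun y => ‖convOp K (fun z => g (-z)) y‖ₑ ^ q')
  have hfinal : X ≤ (∫⁻ x, ‖f x‖ₑ ^ q) ^ (1 / q) * (C * X) ^ (1 / q') := by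
    refine hXeq.trans_le ?_
    rw [integral_convOp_mul hqq hK.continuous hK.bound hf hfin hgm (by rwa [hgX])]
    refine (enorm_integral_le_lintegral_enorm _).trans ?_
    simp only [enorm_mul]
    refine (ENNReal.lintegral_mul_le_Lp_mul_Lq volume hqq hf.enorm
      (aestronglyMeasurable_convOp hKn hgm).enorm).trans ?_
    gcongr
  rcases eq_or_ne X 0 with h0 | h0
  · rw [h0]; exact zero_le
  have h1 : X ^ (1 / q) ≤ C ^ (1 / q') * (∫⁻ x, ‖f x‖ₑ ^ q) ^ (1 / q) := by
    have hXq : X ^ (1 / q') ≠ 0 := by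
      rw [Ne, ENNReal.rpow_eq_zero_iff_of_pos (one_div_pos.2 hq'0)]; exact h0
    have hXqt : X ^ (1 / q') ≠ ∞ := ENNReal.rpow_ne_top_of_nonneg (one_div_nonneg.2 hq'0.le) hX
    rw [← ENNReal.mul_le_mul_iff_left hXq hXqt, ← ENNReal.rpow_add _ _ h0 hX]
    have : 1 / q + 1 / q' = 1 := by
      simpa [one_div] using hqq.inv_add_inv_eq_one
    rw [this, ENNReal.rpow_one]
    refine hfinal.trans_eq ?_
    rw [ENNReal.mul_rpow_of_nonneg _ _ (one_div_nonneg.2 hq'0.le)]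
    ring
  calc X = (X ^ (1 / q)) ^ q := by
        rw [← ENNReal.rpow_mul, one_div_mul_cancel hq0.ne', ENNReal.rpow_one]
    _ ≤ (C ^ (1 / q') * (∫⁻ x, ‖f x‖ₑ ^ q) ^ (1 / q)) ^ q := by gcongr
    _ = _ := by
        rw [ENNReal.mul_rpow_of_nonneg _ _ hq0.le, ← ENNReal.rpow_mul (∫⁻ x, ‖f x‖ₑ ^ q),
          one_div_mul_cancel hq0.ne', ENNReal.rpow_one, ENNReal.coe_rpow_of_nonneg _ hq0.le,
          ENNReal.coe_rpow_of_nonneg _ (one_div_nonneg.2 hq'0.le)]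

/-- Convolution with a Calderón–Zygmund kernel is bounded on `L^q` for `1 < q < ∞`, with a constant
that depends only on `q`, the space and the constant of the kernel. -/
theorem exists_convOp_lp (E : Type*) [NormedAddCommGroup E] [InnerProductSpace ℝ E]
    [FiniteDimensional ℝ E] [MeasurableSpace E] [BorelSpace E] [Nontrivial E] (A : ℝ≥0) {q : ℝ}
    (hq : 1 < q) :
    ∃ C : ℝ≥0, ∀ K : E → ℂ, IsCZKernel A K → ∀ f : E → ℂ, AEStronglyMeasurable f volume →
      ∫⁻ x, ‖f x‖ₑ ^ q ≠ ∞ → ∫⁻ x, ‖convOp K f x‖ₑ ^ q ≤ C * ∫⁻ x, ‖f x‖ₑ ^ q := by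
  rcases lt_trichotomy q 2 with h | rfl | h
  · exact exists_convOp_lp_of_lt_two E A hq h
  · refine ⟨A, fun K hK f hf hfin => hK.l2_bound f ⟨hf, ?_⟩⟩
    rw [eLpNorm_lt_top_iff_lintegral_rpow_enorm_lt_top (by simp) (by simp)]
    simpa using hfin.lt_top
  · exact exists_convOp_lp_of_two_lt E A h

end CalderonZygmundLp

/-! ### `L²` bounds from bounded Fourier multipliers -/

section FourierMultiplier

open Metric Set Module FourierTransform

variable {E : Type*} [NormedAddCommGroup E] [InnerProductSpace ℝ E] [FiniteDimensional ℝ E]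
  [MeasurableSpace E] [BorelSpace E]

theorem eLpNorm_fourier_schwartz (f : 𝓢(E, ℂ)) :
    eLpNorm (𝓕 f : 𝓢(E, ℂ)) 2 volume = eLpNorm f 2 volume := by
  have h := SchwartzMap.norm_fourier_toL2_eq f
  have h1 : ‖(𝓕 f : 𝓢(E, ℂ)).toLp 2 volume‖ = (eLpNorm (𝓕 f : 𝓢(E, ℂ)) 2 volume).toReal :=
    SchwartzMap.norm_toLp
  have h2 : ‖f.toLp 2 volume‖ = (eLpNorm f 2 volume).toReal := SchwartzMap.norm_toLp
  have h3 := (h1.symm.trans h).trans h2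
  exact (ENNReal.toReal_eq_toReal_iff' ((𝓕 f : 𝓢(E, ℂ)).memLp 2 volume).2.ne
    (f.memLp 2 volume).2.ne).1 h3

theorem convOp_schwartz (κ f : 𝓢(E, ℂ)) (x : E) :
    convOp κ f x = SchwartzMap.convolution (ContinuousLinearMap.mul ℂ ℂ) κ f x := by
  rw [SchwartzMap.convolution_apply, convolution_mul_swap, convOp]

theorem eLpNorm_convOp_schwartz_le {κ : 𝓢(E, ℂ)} {c : ℝ≥0} (hc : ∀ ξ, ‖𝓕 κ ξ‖ ≤ c)
    (f : 𝓢(E, ℂ)) : eLpNorm (convOp κ f) 2 volume ≤ c * eLpNorm f 2 volume := by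
  have e : convOp κ f = SchwartzMap.convolution (ContinuousLinearMap.mul ℂ ℂ) κ f :=
    funext (convOp_schwartz κ f)
  rw [e, ← eLpNorm_fourier_schwartz, ← eLpNorm_fourier_schwartz f]
  refine (eLpNorm_le_nnreal_smul_eLpNorm_of_ae_le_mul (c := c) (g := (𝓕 f : 𝓢(E, ℂ)))
    (.of_forall fun ξ => ?_) 2).trans_eq rfl
  rw [SchwartzMap.fourier_convolution, SchwartzMap.pairing_apply_apply,
    ContinuousLinearMap.mul_apply', nnnorm_mul]
  gcongr
  exact hc ξ

theorem lintegral_rpow_enorm_eq {X F : Type*} [MeasurableSpace X] {μ : Measure X} [ENorm F]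
    {p : ℝ≥0∞} (h0 : p ≠ 0) (ht : p ≠ ∞) (f : X → F) :
    ∫⁻ x, ‖f x‖ₑ ^ p.toReal ∂μ = eLpNorm f p μ ^ p.toReal := by
  rw [eLpNorm_eq_lintegral_rpow_enorm_toReal h0 ht, ← ENNReal.rpow_mul, one_div_mul_cancel
    (ENNReal.toReal_pos h0 ht).ne', ENNReal.rpow_one]

theorem lintegral_convOp_sq_le [Nontrivial E] {κ : 𝓢(E, ℂ)} {c : ℝ≥0}
    (hc : ∀ ξ, ‖𝓕 κ ξ‖ ≤ c) {f : E → ℂ} (hf : MemLp f 2 volume) :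
    ∫⁻ x, ‖convOp κ f x‖ₑ ^ (2 : ℝ) ≤ (c ^ 2 : ℝ≥0) * ∫⁻ x, ‖f x‖ₑ ^ (2 : ℝ) := by
  obtain ⟨C, hC⟩ := exists_convOp_lp_of_bound E one_lt_two κ.exists_norm_le_poissonMaj
  have e2 : (2 : ℝ) = (2 : ℝ≥0∞).toReal := by simp
  have hqual : ∀ g : E → ℂ, AEStronglyMeasurable g volume →
      eLpNorm (convOp κ g) 2 volume ≤ (C ^ (2⁻¹ : ℝ) : ℝ≥0) * eLpNorm g 2 volume := fun g hg => by
    have := hC g hg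
    rw [e2, lintegral_rpow_enorm_eq (by simp) (by simp),
      lintegral_rpow_enorm_eq (by simp) (by simp), ← e2] at this
    rw [← ENNReal.rpow_le_rpow_iff two_pos, ENNReal.mul_rpow_of_nonneg _ _ two_pos.le,
      ENNReal.coe_rpow_of_nonneg _ (by norm_num), ← ENNReal.rpow_mul]
    simpa using this
  set D : ℝ≥0 := C ^ (2⁻¹ : ℝ) with hD
  have hmain : eLpNorm (convOp κ f) 2 volume ≤ c * eLpNorm f 2 volume := by
    -- Approximation by Schwartz functions, to which Plancherel applies; the uncontrolled constant
    -- `D` multiplies only `ε`.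
    have happ : ∀ ε : ℝ≥0, 0 < ε → eLpNorm (convOp κ f) 2 volume ≤
        c * eLpNorm f 2 volume + (c + D) * ε := fun ε hε => by
      have hd := SchwartzMap.denseRange_toLpCLM (E := E) (F := ℂ) (p := 2) (μ := volume)
        (by simp)
      obtain ⟨g, hg⟩ := hd.exists_dist_lt (hf.toLp f) (ε := ε) hε
      rw [SchwartzMap.toLpCLM_apply, dist_eq_norm] at hg
      have hgf : eLpNorm (f - ⇑g) 2 volume ≤ ε := by
        have h1 : hf.toLp f - g.toLp 2 volume = (hf.sub (g.memLp 2 volume)).toLp (f - ⇑g) := rfl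
        rw [h1, Lp.norm_toLp] at hg
        exact ((ENNReal.lt_ofReal_iff_toReal_lt (hf.sub (g.memLp 2 volume)).2.ne).2 hg).le.trans_eq
          ENNReal.ofReal_coe_nnreal
      obtain ⟨x₀, hx₀⟩ := (maximalFn_ae_ne_top one_lt_two hf.1.enorm (by
        rw [e2, lintegral_rpow_enorm_eq (by simp) (by simp)]
        exact ENNReal.rpow_ne_top_of_nonneg (by simp) hf.2.ne)).exists
      obtain ⟨x₁, hx₁⟩ := (maximalFn_ae_ne_top one_lt_two (g.memLp 2 volume).1.enorm (by
        rw [e2, lintegral_rpow_enorm_eq (by simp) (by simp)]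
        exact ENNReal.rpow_ne_top_of_nonneg (by simp) (g.memLp 2 volume).2.ne)).exists
      have hlin : convOp κ f = convOp κ (f - ⇑g) + convOp κ g := by
        ext x
        have h1 := integrable_kernel_mul κ.continuous κ.exists_norm_le_poissonMaj hf.1 hx₀ x
        have h2 := integrable_kernel_mul κ.continuous κ.exists_norm_le_poissonMaj
          (g.memLp 2 volume).1 hx₁ x
        simp only [Pi.add_apply, convOp, Pi.sub_apply, mul_sub]
        rw [integral_sub h1 h2, sub_add_cancel]
      have hfgm : AEStronglyMeasurable (f - ⇑g) volume := hf.1.sub (g.memLp 2 volume).1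
      calc eLpNorm (convOp κ f) 2 volume
          ≤ eLpNorm (convOp κ (f - ⇑g)) 2 volume + eLpNorm (convOp κ g) 2 volume := by
            rw [hlin]
            exact eLpNorm_add_le (aestronglyMeasurable_convOp κ.continuous hfgm)
              (aestronglyMeasurable_convOp κ.continuous (g.memLp 2 volume).1) (by simp)
        _ ≤ D * ε + c * (eLpNorm f 2 volume + ε) := by
            gcongr
            · exact (hqual _ hfgm).trans (by gcongr)
            · refine (eLpNorm_convOp_schwartz_le hc g).trans ?_
              gcongr
              have : (g : E → ℂ) = f - (f - ⇑g) := by ext; simp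
              rw [this]
              refine (eLpNorm_sub_le hf.1 hfgm (by simp)).trans ?_
              gcongr
        _ = _ := by ring
    have hlim : Filter.Tendsto (fun ε : ℝ≥0 => c * eLpNorm f 2 volume + (c + D) * (ε : ℝ≥0∞))
        (nhdsWithin 0 (Ioi 0)) (nhds (c * eLpNorm f 2 volume + (c + D) * ((0 : ℝ≥0) : ℝ≥0∞))) := by
      refine Filter.Tendsto.mono_left (Continuous.tendsto ?_ 0) nhdsWithin_le_nhds
      exact continuous_const.add ((ENNReal.continuous_const_mul (by finiteness)).comp
        ENNReal.continuous_coe)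
    rw [ENNReal.coe_zero, mul_zero, add_zero] at hlim
    exact ge_of_tendsto hlim (by
      filter_upwards [self_mem_nhdsWithin] with ε hε using happ ε hε)
  rw [e2, lintegral_rpow_enorm_eq (by simp) (by simp), lintegral_rpow_enorm_eq (by simp) (by simp),
    ← e2]
  refine (ENNReal.rpow_le_rpow hmain zero_le_two).trans_eq ?_
  rw [ENNReal.mul_rpow_of_nonneg _ _ zero_le_two]
  simp

end FourierMultiplier

/-! ### The differential transform kernels are uniformly Calderón–Zygmund -/

section DifferenceKernel

open Metric Set Module FourierTransform

variable {n : ℕ}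

theorem continuous_dilate (φ : 𝓢(EuclideanSpace ℝ (Fin n), ℝ)) (t : ℝ) :
    Continuous (dilate φ t) := by
  have := φ.continuous
  unfold dilate
  fun_prop

/-- The dilate of a real-valued Schwartz function as a complex-valued Schwartz function. -/
noncomputable def schwartzDilate (φ : 𝓢(EuclideanSpace ℝ (Fin n), ℝ)) (t : ℝ) :
    𝓢(EuclideanSpace ℝ (Fin n), ℂ) :=
  if ht : t = 0 then 0 else ((t ^ n)⁻¹ : ℝ) • SchwartzMap.compCLMOfContinuousLinearEquiv ℝ
    (ContinuousLinearEquiv.smulLeft (R₁ := ℝ) (Units.mk0 t ht)⁻¹)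
    (SchwartzMap.postcompCLM Complex.ofRealCLM φ)

theorem schwartzDilate_apply (φ : 𝓢(EuclideanSpace ℝ (Fin n), ℝ)) {t : ℝ} (ht : 0 < t)
    (x : EuclideanSpace ℝ (Fin n)) : schwartzDilate φ t x = (dilate φ t x : ℂ) := by
  rw [schwartzDilate, dif_neg ht.ne', dilate, smul_apply,
    SchwartzMap.compCLMOfContinuousLinearEquiv_apply, Function.comp_apply,
    SchwartzMap.postcompCLM_apply, Complex.real_smul]
  push_cast
  rfl

theorem fourier_schwartzDilate (φ : 𝓢(EuclideanSpace ℝ (Fin n), ℝ)) {t : ℝ} (ht : 0 < t)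
    (ξ : EuclideanSpace ℝ (Fin n)) :
    𝓕 (schwartzDilate φ t) ξ = 𝓕 (SchwartzMap.postcompCLM Complex.ofRealCLM φ) (t • ξ) := by
  rw [SchwartzMap.fourier_coe, SchwartzMap.fourier_coe, Real.fourier_eq, Real.fourier_eq]
  have h := Measure.integral_comp_inv_smul volume
    (fun v => Real.fourierChar (-inner ℝ v (t • ξ)) •
      (SchwartzMap.postcompCLM Complex.ofRealCLM φ : 𝓢(EuclideanSpace ℝ (Fin n), ℂ)) v) t
  rw [finrank_euclideanSpace_fin, abs_of_pos (by positivity)] at h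
  rw [← inv_smul_eq_iff₀ (by positivity), ← integral_smul] at h
  rw [← h]
  refine integral_congr_ae (.of_forall fun v => ?_)
  simp only [schwartzDilate_apply φ ht, dilate, inner_smul_left, inner_smul_right,
    SchwartzMap.postcompCLM_apply, Complex.ofRealCLM_apply, conj_trivial]
  rw [mul_inv_cancel_left₀ ht.ne', smul_comm (t ^ n)⁻¹, Complex.real_smul, Complex.ofReal_mul]

/-- The kernel of the differential transform `∑ v_i (Φ_{a_{i+1}} - Φ_{a_i})`, the sum being taken
over `N₁ ≤ i ≤ N₂`. -/
noncomputable def diffKernel (φ : EuclideanSpace ℝ (Fin n) → ℝ) (a : ℤ → ℝ) (v : ℤ → ℂ)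
    (N₁ N₂ : ℤ) (x : EuclideanSpace ℝ (Fin n)) : ℂ :=
  ∑ i ∈ Finset.Icc N₁ N₂, v i * ((dilate φ (a (i + 1)) x : ℂ) - (dilate φ (a i) x : ℂ))

theorem diffKernel_eq_schwartz (φ : 𝓢(EuclideanSpace ℝ (Fin n), ℝ)) {a : ℤ → ℝ}
    (ha : ∀ i, 0 < a i) (v : ℤ → ℂ) (N₁ N₂ : ℤ) :
    diffKernel φ a v N₁ N₂ = (∑ i ∈ Finset.Icc N₁ N₂,
      v i • (schwartzDilate φ (a (i + 1)) - schwartzDilate φ (a i)) :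
        𝓢(EuclideanSpace ℝ (Fin n), ℂ)) := by
  ext x
  simp [diffKernel, schwartzDilate_apply φ (ha _)]

theorem sum_norm_sub_le {F : Type*} [NormedAddCommGroup F] (w : ℤ → F) (b : ℤ → ℝ) (C S : ℝ)
    {N₁ N₂ : ℤ} (h : ∀ i, ‖w i‖ ≤ C * b i) (hb0 : ∑ i ∈ Finset.Icc N₁ N₂, b i ≤ S)
    (hb1 : ∑ i ∈ Finset.Icc N₁ N₂, b (i + 1) ≤ S) (hC : 0 ≤ C) :
    ∑ i ∈ Finset.Icc N₁ N₂, ‖w (i + 1) - w i‖ ≤ 2 * C * S := by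
  calc _ ≤ ∑ i ∈ Finset.Icc N₁ N₂, (C * b (i + 1) + C * b i) := by
        refine Finset.sum_le_sum fun i _ => (norm_sub_le _ _).trans ?_
        gcongr <;> exact h _
    _ = C * ∑ i ∈ Finset.Icc N₁ N₂, b (i + 1) + C * ∑ i ∈ Finset.Icc N₁ N₂, b i := by
        rw [Finset.sum_add_distrib, Finset.mul_sum, Finset.mul_sum]
    _ ≤ C * S + C * S := by gcongr
    _ = _ := by ring

/-- The transform of `φ_t` at `ξ` is that of `φ` at `t • ξ`, close to `1` for small `t ‖ξ‖` and to
`0` for large. After subtracting the corresponding step function, each term obeys the lacunary `min`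
bound. -/
theorem exists_fourier_diffKernel_le (φ : 𝓢(EuclideanSpace ℝ (Fin n), ℝ)) (hφ : ∫ x, φ x = 1)
    {δ : ℝ} (hδ : 1 < δ) :
    ∃ C : ℝ, 0 ≤ C ∧ ∀ a : ℤ → ℝ, IsLacunary δ a → ∀ N₁ N₂ : ℤ, ∀ ξ,
      ∑ i ∈ Finset.Icc N₁ N₂,
        ‖𝓕 (schwartzDilate φ (a (i + 1))) ξ - 𝓕 (schwartzDilate φ (a i)) ξ‖ ≤ C := by
  set ψ : 𝓢(EuclideanSpace ℝ (Fin n), ℂ) := SchwartzMap.postcompCLM Complex.ofRealCLM φ with hψ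
  have hψ0 : 𝓕 ψ 0 = 1 := by
    rw [SchwartzMap.fourier_coe, Real.fourier_eq]
    simp only [inner_zero_right, neg_zero, AddChar.map_zero_eq_one, one_smul]
    have : ∀ x, ψ x = ((φ x : ℝ) : ℂ) := fun x => rfl
    simp only [this]
    rw [integral_complex_ofReal, hφ, Complex.ofReal_one]
  obtain ⟨C₁, hC₁, h1⟩ := (𝓕 ψ).exists_decay 1
  obtain ⟨C₂, hC₂, h2⟩ := (𝓕 ψ).exists_diff_le 0
  have hκ : 0 < δ / (δ - 1) := div_pos (by linarith) (by linarith)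
  refine ⟨2 * (C₁ + C₂) * (2 * (δ / (δ - 1))) + 1, by positivity, fun a ha N₁ N₂ ξ => ?_⟩
  rcases lt_or_ge N₂ N₁ with hN | hN
  · rw [Finset.Icc_eq_empty_of_lt hN, Finset.sum_empty]; positivity
  simp only [fourier_schwartzDilate φ (ha.pos _), ← hψ]
  rcases eq_or_ne ξ 0 with rfl | hξ
  · simp; positivity
  have hξ : 0 < ‖ξ‖ := norm_pos_iff.2 hξ
  -- Decreasing in `i` with values in `{0, 1}`, so its total variation is at most `1`: this is the
  -- `+ 1` in the constant.
  set χ : ℤ → ℝ := fun i => if a i * ‖ξ‖ < 1 then 1 else 0 with hχ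
  have hχmono : ∀ i, χ (i + 1) ≤ χ i := fun i => by
    have := ha.lt_succ hδ i
    simp only [hχ]
    split_ifs with h3 h4 h4
    · exact le_rfl
    · exfalso; nlinarith
    · exact zero_le_one
    · exact le_rfl
  set w : ℤ → ℂ := fun i => 𝓕 ψ (a i • ξ) - (χ i : ℂ) with hw
  set b : ℤ → ℝ := fun i => min (a i / ‖ξ‖⁻¹) (‖ξ‖⁻¹ / a i) with hb
  have hwb : ∀ i, ‖w i‖ ≤ (C₁ + C₂) * b i := fun i => by
    have hai := ha.pos i
    have e1 : a i / ‖ξ‖⁻¹ = a i * ‖ξ‖ := div_inv_eq_mul _ _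
    have e2 : ‖ξ‖⁻¹ / a i = (a i * ‖ξ‖)⁻¹ := by field_simp
    have hpos : 0 < a i * ‖ξ‖ := by positivity
    have hn : ‖a i • ξ‖ = a i * ‖ξ‖ := by rw [norm_smul, Real.norm_of_nonneg hai.le]
    simp only [hw, hb, hχ, e1, e2]
    split_ifs with h3
    · rw [min_eq_left (h3.le.trans ((one_le_inv₀ hpos).2 h3.le)), Complex.ofReal_one, ← hψ0]
      have := (h2 0 (-(a i • ξ))).1
      rw [zero_sub, neg_neg, norm_neg, hn] at this
      simp only [pow_zero, mul_one, div_one] at this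
      nlinarith
    · rw [min_eq_right (((inv_le_one₀ hpos).2 (not_lt.1 h3)).trans (not_lt.1 h3)),
        Complex.ofReal_zero, sub_zero]
      refine ((h1 (a i • ξ)).1).trans ?_
      rw [hn, pow_one, ← div_eq_mul_inv]
      gcongr <;> linarith
  have hsum := sum_norm_sub_le (N₁ := N₁) (N₂ := N₂) w b (C₁ + C₂) (2 * (δ / (δ - 1))) hwb
    (ha.sum_min_le hδ (inv_pos.2 hξ) N₁ N₂) (ha.shift.sum_min_le hδ (inv_pos.2 hξ) N₁ N₂)
    (by positivity)
  calc _ ≤ ∑ i ∈ Finset.Icc N₁ N₂, (‖w (i + 1) - w i‖ + (χ i - χ (i + 1))) := by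
        refine Finset.sum_le_sum fun i _ => ?_
        have e : 𝓕 ψ (a (i + 1) • ξ) - 𝓕 ψ (a i • ξ) =
            (w (i + 1) - w i) + ((χ (i + 1) - χ i : ℝ) : ℂ) := by
          simp only [hw]; push_cast; ring
        rw [e]
        refine (norm_add_le _ _).trans ?_
        rw [Complex.norm_real, Real.norm_eq_abs, abs_sub_comm, abs_of_nonneg
          (sub_nonneg.2 (hχmono i))]
    _ ≤ _ := by
        rw [Finset.sum_add_distrib]
        gcongr
        have := sum_Icc_int_sub (fun i => - χ i) hN
        simp only [sub_neg_eq_add] at this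
        rw [show ∑ i ∈ Finset.Icc N₁ N₂, (χ i - χ (i + 1)) =
          ∑ i ∈ Finset.Icc N₁ N₂, (-χ (i + 1) + χ i) from
            Finset.sum_congr rfl fun i _ => by ring, this]
        have h5 : χ N₁ ≤ 1 := by simp only [hχ]; split_ifs <;> norm_num
        have h6 : 0 ≤ χ (N₂ + 1) := by simp only [hχ]; split_ifs <;> norm_num
        linarith

/-- The kernels of the differential transforms are Calderón–Zygmund kernels, uniformly in the
lacunary sequence, the bounded sequence and the range of summation. -/
theorem exists_isCZKernel_diffKernel [Nonempty (Fin n)] (φ : 𝓢(EuclideanSpace ℝ (Fin n), ℝ))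
    (hφ : ∫ x, φ x = 1) {δ : ℝ} (hδ : 1 < δ) {M : ℝ} (hM : 0 ≤ M) :
    ∃ A : ℝ≥0, ∀ a : ℤ → ℝ, IsLacunary δ a → ∀ v : ℤ → ℂ, (∀ i, ‖v i‖ ≤ M) → ∀ N₁ N₂ : ℤ,
      IsCZKernel A (diffKernel φ a v N₁ N₂) := by
  obtain ⟨C₁, hC₁, h1⟩ := exists_fourier_diffKernel_le φ hφ hδ
  obtain ⟨C₂, hC₂, h2⟩ := exists_dilate_diff_le_min φ
  have hκ : 0 < δ / (δ - 1) := div_pos (by linarith) (by linarith)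
  obtain ⟨c, hc⟩ : ∃ c : ℝ≥0, (c : ℝ) = M * C₁ := ⟨⟨_, by positivity⟩, rfl⟩
  obtain ⟨c', hc'⟩ : ∃ c : ℝ≥0, (c : ℝ) = M * (2 * C₂ * (2 * (δ / (δ - 1)))) :=
    ⟨⟨_, by positivity⟩, rfl⟩
  -- `c` bounds the multiplier and is squared because the `L²` condition is stated for squared
  -- norms; `c'` is the smoothness constant.
  refine ⟨c ^ 2 + c', fun a ha v hv N₁ N₂ => ?_⟩
  have e := diffKernel_eq_schwartz φ ha.pos v N₁ N₂
  set κ : 𝓢(EuclideanSpace ℝ (Fin n), ℂ) := ∑ i ∈ Finset.Icc N₁ N₂,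
      v i • (schwartzDilate φ (a (i + 1)) - schwartzDilate φ (a i)) with hκdef
  refine ⟨e ▸ κ.continuous, e ▸ κ.exists_norm_le_poissonMaj, fun f hf => ?_, fun x z hz => ?_⟩
  · have hF : ∀ ξ, ‖𝓕 κ ξ‖ ≤ c := fun ξ => by
      have e2 : 𝓕 κ ξ = ∑ i ∈ Finset.Icc N₁ N₂,
          v i * (𝓕 (schwartzDilate φ (a (i + 1))) ξ - 𝓕 (schwartzDilate φ (a i)) ξ) := by
        change fourierCLM ℂ 𝓢(EuclideanSpace ℝ (Fin n), ℂ) κ ξ = _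
        rw [hκdef, map_sum, sum_apply]
        refine Finset.sum_congr rfl fun i _ => ?_
        rw [map_smul, map_sub]
        rfl
      rw [e2, hc]
      calc _ ≤ ∑ i ∈ Finset.Icc N₁ N₂, M *
          ‖𝓕 (schwartzDilate φ (a (i + 1))) ξ - 𝓕 (schwartzDilate φ (a i)) ξ‖ := by
            refine norm_sum_le_of_le _ fun i _ => ?_
            rw [norm_mul]
            gcongr
            exact hv i
        _ ≤ M * C₁ := by
            rw [← Finset.mul_sum]
            gcongr
            exact h1 a ha N₁ N₂ ξ
    rw [e]
    refine (lintegral_convOp_sq_le hF hf).trans ?_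
    gcongr
    exact le_self_add
  · rcases eq_or_ne x 0 with rfl | hx
    · have : z = 0 := by simpa using hz
      simp [this]
    have hx' := norm_pos_iff.2 hx
    set w : ℤ → ℝ := fun i => dilate φ (a i) (x - z) - dilate φ (a i) x with hw
    have hsum := sum_norm_sub_le (N₁ := N₁) (N₂ := N₂) w
      (fun i => min (a i / ‖x‖) (‖x‖ / a i)) (C₂ * (‖z‖ / ‖x‖ ^ (n + 1))) (2 * (δ / (δ - 1)))
      (fun i => h2 (a i) (ha.pos i) x z hx hz)
      (ha.sum_min_le hδ hx' N₁ N₂) (ha.shift.sum_min_le hδ hx' N₁ N₂) (by positivity)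
    rw [finrank_euclideanSpace_fin]
    have e3 : diffKernel φ a v N₁ N₂ (x - z) - diffKernel φ a v N₁ N₂ x =
        ∑ i ∈ Finset.Icc N₁ N₂, v i * ((w (i + 1) - w i : ℝ) : ℂ) := by
      rw [diffKernel, diffKernel, ← Finset.sum_sub_distrib]
      refine Finset.sum_congr rfl fun i _ => ?_
      simp only [hw]
      push_cast
      ring
    rw [e3]
    calc _ ≤ ∑ i ∈ Finset.Icc N₁ N₂, M * ‖w (i + 1) - w i‖ := by
          refine norm_sum_le_of_le _ fun i _ => ?_
          rw [norm_mul, Complex.norm_real]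
          gcongr
          exact hv i
      _ ≤ M * (2 * (C₂ * (‖z‖ / ‖x‖ ^ (n + 1))) * (2 * (δ / (δ - 1)))) := by
          rw [← Finset.mul_sum]
          gcongr
      _ = c' * (‖z‖ / ‖x‖ ^ (n + 1)) := by rw [hc']; ring
      _ ≤ _ := by
          gcongr
          exact le_add_self

end DifferenceKernel

/-! ### Commutation of convolution operators -/

section Commute

open Metric Set Module

variable {E : Type*} [NormedAddCommGroup E] [InnerProductSpace ℝ E] [FiniteDimensional ℝ E]
  [MeasurableSpace E] [BorelSpace E]

theorem maximalFn_const_mul_le (c : ℝ≥0) (g : E → ℝ≥0∞) (x : E) :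
    maximalFn (fun y => c * g y) x ≤ c * maximalFn g x := by
  refine maximalFn_le_iff.2 fun z r hx => ?_
  rw [lintegral_const_mul' _ _ ENNReal.coe_ne_top, mul_assoc, mul_comm (maximalFn g x)]
  gcongr
  exact lintegral_ball_le_maximalFn g hx

theorem maximalFn_one_le (x : E) : maximalFn (fun _ => 1) x ≤ 1 := by
  refine maximalFn_le_iff.2 fun z r hx => ?_
  rw [setLIntegral_const]

theorem integrable_convOp_convOp [Nontrivial E] {K L f : E → ℂ} (hKc : Continuous K)
    (hLc : Continuous L) (hK : ∃ B : ℝ≥0, ∀ x, ‖K x‖ ≤ B * poissonMaj 1 x)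
    (hL : ∃ B : ℝ≥0, ∀ x, ‖L x‖ ≤ B * poissonMaj 1 x) (hf : AEStronglyMeasurable f volume) {x : E}
    (hx : maximalFn (maximalFn fun y => ‖f y‖ₑ) x ≠ ∞) :
    Integrable (fun z : E × E => K (x - z.1) * (L (z.1 - z.2) * f z.2))
      (volume.prod volume) := by
  have hmeas : AEStronglyMeasurable (fun z : E × E => K (x - z.1) * (L (z.1 - z.2) * f z.2))
      (volume.prod volume) :=
    (hKc.comp (continuous_const.sub continuous_fst)).aestronglyMeasurable.mul
      ((hLc.comp (continuous_fst.sub continuous_snd)).aestronglyMeasurable.mul hf.comp_snd)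
  refine ⟨hmeas, ?_⟩
  rw [hasFiniteIntegral_iff_enorm, lintegral_prod _ hmeas.enorm]
  obtain ⟨C, hC⟩ := exists_lintegral_poissonMaj_le E
  obtain ⟨B, hB⟩ := hK
  obtain ⟨B', hB'⟩ := hL
  set m := maximalFn (fun y => ‖f y‖ₑ) with hm
  have hmm : Measurable m := measurable_maximalFn _
  have hen : ∀ {K : E → ℂ} {B : ℝ≥0}, (∀ x, ‖K x‖ ≤ B * poissonMaj 1 x) →
      ∀ x, ‖K x‖ₑ ≤ B * ENNReal.ofReal (poissonMaj 1 x) := fun {K B} h x => by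
    rw [← ofReal_norm, ← ENNReal.ofReal_coe_nnreal, ← ENNReal.ofReal_mul (by positivity)]
    exact ENNReal.ofReal_le_ofReal (h x)
  calc ∫⁻ y, ∫⁻ w, ‖K (x - y) * (L (y - w) * f w)‖ₑ
      ≤ ∫⁻ y, (B * B' * C : ℝ≥0∞) * (ENNReal.ofReal (poissonMaj 1 (x - y)) * m y) := by
        refine lintegral_mono fun y => ?_
        calc ∫⁻ w, ‖K (x - y) * (L (y - w) * f w)‖ₑ
            ≤ ∫⁻ w, (‖K (x - y)‖ₑ * B') * (ENNReal.ofReal (poissonMaj 1 (y - w)) * ‖f w‖ₑ) := by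
              refine lintegral_mono fun w => ?_
              rw [enorm_mul, enorm_mul, mul_assoc, ← mul_assoc (B' : ℝ≥0∞)]
              gcongr
              exact hen hB' _
          _ ≤ (B * ENNReal.ofReal (poissonMaj 1 (x - y)) * B') * (C * m y) := by
              rw [lintegral_const_mul' _ _ (by finiteness)]
              gcongr
              · exact hen hB _
              · exact hC 1 one_pos _ hf.enorm y
          _ = _ := by ring
    _ ≤ (B * B' * C : ℝ≥0∞) * (C * maximalFn m x) := by
        rw [lintegral_const_mul' _ _ (by finiteness)]
        gcongr
        exact hC 1 one_pos _ hmm.aemeasurable x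
    _ < ∞ := by finiteness

/-- Finiteness of the iterated maximal function makes both double integrals absolutely convergent.
After exchanging the order of integration, the substitution `y ↦ x + w - y` interchanges the
kernels. -/
theorem convOp_comm [Nontrivial E] {K L f : E → ℂ} (hKc : Continuous K)
    (hLc : Continuous L) (hK : ∃ B : ℝ≥0, ∀ x, ‖K x‖ ≤ B * poissonMaj 1 x)
    (hL : ∃ B : ℝ≥0, ∀ x, ‖L x‖ ≤ B * poissonMaj 1 x) (hf : AEStronglyMeasurable f volume) {x : E}
    (hx : maximalFn (maximalFn fun y => ‖f y‖ₑ) x ≠ ∞) :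
    convOp K (convOp L f) x = convOp L (convOp K f) x := by
  have h1 := integrable_convOp_convOp hKc hLc hK hL hf hx
  have h2 := integrable_convOp_convOp hLc hKc hL hK hf hx
  have e : ∀ K L : E → ℂ,
      convOp K (convOp L f) x = ∫ y, ∫ w, K (x - y) * (L (y - w) * f w) := fun K L => by
    simp only [convOp, integral_const_mul]
  have s1 : ∫ y, ∫ w, K (x - y) * (L (y - w) * f w) = ∫ w, ∫ y, K (x - y) * (L (y - w) * f w) :=
    integral_integral_swap h1
  have s2 : ∫ y, ∫ w, L (x - y) * (K (y - w) * f w) = ∫ w, ∫ y, L (x - y) * (K (y - w) * f w) :=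
    integral_integral_swap h2
  rw [e K L, e L K, s1, s2]
  refine integral_congr_ae (.of_forall fun w => ?_)
  simp only
  rw [← integral_sub_left_eq_self _ volume (x + w)]
  refine integral_congr_ae (.of_forall fun y => ?_)
  simp only
  rw [show x - (x + w - y) = y - w by abel, show x + w - y - w = x - y by abel]
  ring

end Commute

/-! ### Almost orthogonality and Cotlar's inequality -/

section Cotlar

open Metric Set Module

variable {n : ℕ}

/-- The dilate `φ_t` as a complex-valued kernel. -/
noncomputable def dilateC (φ : EuclideanSpace ℝ (Fin n) → ℝ) (t : ℝ)
    (x : EuclideanSpace ℝ (Fin n)) : ℂ := dilate φ t x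

theorem approxId_eq_convOp (φ : EuclideanSpace ℝ (Fin n) → ℝ) (t : ℝ)
    (f : EuclideanSpace ℝ (Fin n) → ℂ) : approxId φ t f = convOp (dilateC φ t) f := by
  ext x
  rw [approxId, convolution_eq_swap, convOp]
  rfl

theorem continuous_dilateC (φ : 𝓢(EuclideanSpace ℝ (Fin n), ℝ)) (t : ℝ) :
    Continuous (dilateC φ t) := Complex.continuous_ofReal.comp (continuous_dilate φ t)

theorem exists_dilateC_le (φ : 𝓢(EuclideanSpace ℝ (Fin n), ℝ)) :
    ∃ B : ℝ≥0, ∀ t, 0 < t → ∀ x, ‖dilateC φ t x‖ ≤ B * poissonMaj t x := by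
  obtain ⟨C, hC, h⟩ := exists_dilate_le φ
  refine ⟨⟨C, hC.le⟩, fun t ht x => ?_⟩
  rw [dilateC, Complex.norm_real]
  exact h t ht x

theorem dilateC_bound (φ : 𝓢(EuclideanSpace ℝ (Fin n), ℝ)) {t : ℝ} (ht : 0 < t) :
    ∃ B : ℝ≥0, ∀ x, ‖dilateC φ t x‖ ≤ B * poissonMaj 1 x := by
  have : dilateC φ t = schwartzDilate φ t := by
    ext x; rw [schwartzDilate_apply φ ht, dilateC]
  rw [this]
  exact SchwartzMap.exists_norm_le_poissonMaj _

theorem integral_dilateC (φ : 𝓢(EuclideanSpace ℝ (Fin n), ℝ)) (hφ : ∫ x, φ x = 1) {t : ℝ}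
    (ht : 0 < t) : ∫ x, dilateC φ t x = 1 := by
  have h := Measure.integral_comp_inv_smul volume (fun x => φ x) t
  rw [finrank_euclideanSpace_fin, abs_of_pos (by positivity), hφ] at h
  simp only [dilateC, dilate]
  rw [integral_complex_ofReal, integral_const_mul, h, smul_eq_mul, mul_one,
    inv_mul_cancel₀ (by positivity), Complex.ofReal_one]

theorem exists_weighted_dilate_le (φ : 𝓢(EuclideanSpace ℝ (Fin n), ℝ)) :
    ∃ C : ℝ, 0 < C ∧ ∀ s t, 0 < s → s ≤ t → ∀ z,
      |dilate φ s z| * (‖z‖ / t * (1 + ‖z‖ / t) ^ (n + 1)) ≤ s / t * (C * poissonMaj s z) := by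
  -- The weight has degree `n + 2` in `‖z‖`, and `n + 1` further powers are left for the Poisson
  -- majorant.
  obtain ⟨C, hC, h⟩ := φ.exists_decay (2 * n + 3)
  refine ⟨C, hC, fun s t hs hst z => ?_⟩
  have ht : 0 < t := hs.trans_le hst
  have h1 := (h (s⁻¹ • z)).1
  rw [Real.norm_eq_abs, norm_smul, Real.norm_of_nonneg (by positivity), inv_mul_eq_div] at h1
  rw [dilate, abs_mul, abs_of_pos (by positivity), poissonMaj, finrank_euclideanSpace_fin]
  have hz := norm_nonneg z
  calc (s ^ n)⁻¹ * |φ (s⁻¹ • z)| * (‖z‖ / t * (1 + ‖z‖ / t) ^ (n + 1))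
      ≤ (s ^ n)⁻¹ * (C / (1 + ‖z‖ / s) ^ (2 * n + 3)) *
        (s / t * (1 + ‖z‖ / s) * (1 + ‖z‖ / s) ^ (n + 1)) := by
        gcongr
        rw [div_mul_eq_mul_div]
        gcongr
        rw [mul_add, mul_div_cancel₀ _ hs.ne']
        linarith
    _ = s / t * (C * ((s ^ n)⁻¹ * (1 / (1 + ‖z‖ / s) ^ (n + 1)))) := by
        have : 0 < 1 + ‖z‖ / s := by positivity
        generalize 1 + ‖z‖ / s = u at this
        rw [show 2 * n + 3 = (n + 1) + 1 + (n + 1) by ring, pow_add, pow_add, pow_one]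
        field_simp
    _ = _ := by
        rw [show 1 + ‖z‖ / s = (s + ‖z‖) / s by field_simp, div_pow]
        field_simp
        ring

theorem exists_lintegral_weighted_dilate_le [Nonempty (Fin n)]
    (φ : 𝓢(EuclideanSpace ℝ (Fin n), ℝ)) :
    ∃ C : ℝ≥0, ∀ s t, 0 < s → s ≤ t →
      ∫⁻ z, ENNReal.ofReal (|dilate φ s z| * (‖z‖ / t * (1 + ‖z‖ / t) ^ (n + 1))) ≤
        C * ENNReal.ofReal (s / t) := by
  obtain ⟨C, hC, h⟩ := exists_weighted_dilate_le φ
  obtain ⟨C', hC'⟩ := exists_lintegral_poissonMaj_le (EuclideanSpace ℝ (Fin n))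
  refine ⟨C.toNNReal * C', fun s t hs hst => ?_⟩
  have ht : 0 < t := hs.trans_le hst
  calc _ ≤ ∫⁻ z : EuclideanSpace ℝ (Fin n),
        ENNReal.ofReal (s / t * C) * ENNReal.ofReal (poissonMaj s z) := by
        refine lintegral_mono fun z => ?_
        rw [← ENNReal.ofReal_mul (by positivity), mul_assoc]
        exact ENNReal.ofReal_le_ofReal (h s t hs hst z)
    _ = ENNReal.ofReal (s / t * C) *
        ∫⁻ z : EuclideanSpace ℝ (Fin n), ENNReal.ofReal (poissonMaj s (0 - z)) * 1 := by
        rw [lintegral_const_mul' _ _ ENNReal.ofReal_ne_top]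
        simp only [zero_sub, mul_one, poissonMaj, norm_neg]
    _ ≤ ENNReal.ofReal (s / t * C) * (C' * 1) := by
        gcongr
        exact (hC' s hs _ aemeasurable_const 0).trans (by gcongr; exact maximalFn_one_le _)
    _ = _ := by
        rw [ENNReal.ofReal_mul (by positivity), ENNReal.coe_mul, mul_one]
        rw [ENNReal.ofReal.eq_def C]
        ring

theorem exists_convOp_dilate_diff_le [Nonempty (Fin n)] (φ : 𝓢(EuclideanSpace ℝ (Fin n), ℝ)) :
    ∃ C : ℝ≥0, ∀ t, 0 < t → ∀ f : EuclideanSpace ℝ (Fin n) → ℂ, AEStronglyMeasurable f volume →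
      ∀ x, maximalFn (fun y => ‖f y‖ₑ) x ≠ ∞ → ∀ z,
      ‖convOp (dilateC φ t) f (x - z) - convOp (dilateC φ t) f x‖ₑ ≤
        ENNReal.ofReal (‖z‖ / t * (1 + ‖z‖ / t) ^ (n + 1)) *
          (C * maximalFn (fun y => ‖f y‖ₑ) x) := by
  obtain ⟨C, hC, h⟩ := exists_dilate_diff_le φ
  obtain ⟨C', hC'⟩ := exists_lintegral_poissonMaj_le (EuclideanSpace ℝ (Fin n))
  refine ⟨C.toNNReal * C', fun t ht f hf x hx z => ?_⟩
  have hb := dilateC_bound φ ht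
  have hc := continuous_dilateC φ t
  rw [convOp, convOp, ← integral_sub (integrable_kernel_mul hc hb hf hx _)
    (integrable_kernel_mul hc hb hf hx _)]
  refine (enorm_integral_le_lintegral_enorm _).trans ?_
  set w := ‖z‖ / t * (1 + ‖z‖ / t) ^ (n + 1) with hw
  have hw0 : 0 ≤ w := by positivity
  calc _ ≤ ∫⁻ y, ENNReal.ofReal (C * w) *
        (ENNReal.ofReal (poissonMaj t (x - y)) * ‖f y‖ₑ) := by
        refine lintegral_mono fun y => ?_
        rw [← sub_mul, enorm_mul, ← mul_assoc, ← ENNReal.ofReal_mul (by positivity), ← ofReal_norm]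
        gcongr
        rw [dilateC, dilateC, ← Complex.ofReal_sub, Complex.norm_real, Real.norm_eq_abs,
          sub_right_comm]
        exact h t ht (x - y) z
    _ ≤ ENNReal.ofReal (C * w) * (C' * maximalFn (fun y => ‖f y‖ₑ) x) := by
        rw [lintegral_const_mul' _ _ ENNReal.ofReal_ne_top]
        gcongr
        exact hC' t ht _ hf.enorm x
    _ = _ := by
        rw [ENNReal.ofReal_mul hC.le, ENNReal.coe_mul]
        rw [ENNReal.ofReal.eq_def C]
        ring

/-- Almost orthogonality: for `s ≤ t`, the averages `Φ_s (Φ_t f)` and `Φ_t f` differ by at most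
`s / t` times the maximal function. -/
theorem exists_almost_orthogonality [Nonempty (Fin n)] (φ : 𝓢(EuclideanSpace ℝ (Fin n), ℝ))
    (hφ : ∫ x, φ x = 1) :
    ∃ C : ℝ≥0, ∀ s t, 0 < s → s ≤ t →
      ∀ f : EuclideanSpace ℝ (Fin n) → ℂ, AEStronglyMeasurable f volume →
      ∀ x, maximalFn (fun y => ‖f y‖ₑ) x ≠ ∞ →
      maximalFn (fun y => ‖convOp (dilateC φ t) f y‖ₑ) x ≠ ∞ →
      ‖convOp (dilateC φ s) (convOp (dilateC φ t) f) x - convOp (dilateC φ t) f x‖ ≤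
        C * (maximalFn (fun y => ‖f y‖ₑ) x).toReal * (s / t) := by
  obtain ⟨C, hC⟩ := exists_convOp_dilate_diff_le φ
  obtain ⟨C', hC'⟩ := exists_lintegral_weighted_dilate_le φ
  refine ⟨C' * C, fun s t hs hst f hf x hx hx' => ?_⟩
  have ht : 0 < t := hs.trans_le hst
  set g := convOp (dilateC φ t) f with hg
  have hgm : AEStronglyMeasurable g volume :=
    aestronglyMeasurable_convOp (continuous_dilateC φ t) hf
  have h1 := (integrable_kernel_mul (continuous_dilateC φ s) (dilateC_bound φ hs) hgm hx'
    x).comp_sub_left x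
  simp only [sub_sub_cancel] at h1
  have h2 : Integrable (dilateC φ s) volume := by
    refine Integrable.mono' ((schwartzDilate φ s).integrable.norm)
      (continuous_dilateC φ s).aestronglyMeasurable (.of_forall fun y => ?_)
    rw [schwartzDilate_apply φ hs, dilateC]
  -- Since `φ_s` has integral `1`, the value `g x` can be moved inside the integral.
  have e : convOp (dilateC φ s) g x - g x = ∫ z, dilateC φ s z * (g (x - z) - g x) := by
    simp only [mul_sub]
    rw [integral_sub h1 (h2.mul_const _), integral_mul_const, integral_dilateC φ hφ hs, one_mul,
      convOp, ← integral_sub_left_eq_self _ volume x]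
    simp only [sub_sub_cancel]
  have hmain : ‖convOp (dilateC φ s) g x - g x‖ₑ ≤
      C' * ENNReal.ofReal (s / t) * (C * maximalFn (fun y => ‖f y‖ₑ) x) := by
    rw [e]
    refine (enorm_integral_le_lintegral_enorm _).trans ?_
    calc _ ≤ ∫⁻ z, ENNReal.ofReal (|dilate φ s z| * (‖z‖ / t * (1 + ‖z‖ / t) ^ (n + 1))) *
          (C * maximalFn (fun y => ‖f y‖ₑ) x) := by
          refine lintegral_mono fun z => ?_
          rw [enorm_mul, ENNReal.ofReal_mul (abs_nonneg _), mul_assoc, ← ofReal_norm (dilateC φ s z),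
            dilateC, Complex.norm_real, Real.norm_eq_abs]
          gcongr
          exact hC t ht f hf x hx z
      _ ≤ _ := by
          rw [lintegral_mul_const' _ _ (by finiteness)]
          gcongr
          exact hC' s t hs hst
  have hfin : C' * ENNReal.ofReal (s / t) * (C * maximalFn (fun y => ‖f y‖ₑ) x) ≠ ∞ := by
    finiteness
  have := ENNReal.toReal_mono hfin hmain
  rw [toReal_enorm, ENNReal.toReal_mul, ENNReal.toReal_mul, ENNReal.toReal_mul,
    ENNReal.toReal_ofReal (by positivity), ENNReal.coe_toReal, ENNReal.coe_toReal] at this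
  refine this.trans_eq ?_
  push_cast
  ring

theorem diffTransform_eq_convOp [Nonempty (Fin n)] (φ : 𝓢(EuclideanSpace ℝ (Fin n), ℝ))
    {a : ℤ → ℝ} (ha : ∀ i, 0 < a i) (v : ℤ → ℂ) (N₁ N₂ : ℤ)
    {f : EuclideanSpace ℝ (Fin n) → ℂ} (hf : AEStronglyMeasurable f volume)
    {x₀ : EuclideanSpace ℝ (Fin n)} (hx₀ : maximalFn (fun y => ‖f y‖ₑ) x₀ ≠ ∞) :
    diffTransform (approxId φ) a v N₁ N₂ f = convOp (diffKernel φ a v N₁ N₂) f := by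
  ext x
  have hint : ∀ i, Integrable (fun y => dilateC φ (a i) (x - y) * f y) volume := fun i =>
    integrable_kernel_mul (continuous_dilateC φ _) (dilateC_bound φ (ha i)) hf hx₀ x
  rw [convOp]
  simp only [diffTransform, diffKernel, Finset.sum_mul, approxId_eq_convOp]
  rw [integral_finsetSum]
  · refine Finset.sum_congr rfl fun i _ => ?_
    simp only [mul_assoc]
    rw [integral_const_mul, convOp, convOp, ← integral_sub (hint _) (hint _)]
    simp only [← sub_mul]
    rfl
  · intro i _
    have := ((hint (i + 1)).sub (hint i)).const_mul (v i)
    refine this.congr (.of_forall fun y => ?_)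
    simp only [Pi.sub_apply, dilateC]
    ring

theorem convOp_diffTransform [Nonempty (Fin n)] (φ : 𝓢(EuclideanSpace ℝ (Fin n), ℝ))
    (a : ℤ → ℝ) {t : ℝ} (ht : 0 < t) (v : ℤ → ℂ) (N₁ N₂ : ℤ)
    {f : EuclideanSpace ℝ (Fin n) → ℂ} (hf : AEStronglyMeasurable f volume)
    {x : EuclideanSpace ℝ (Fin n)}
    (hx : ∀ i, maximalFn (fun y => ‖convOp (dilateC φ (a i)) f y‖ₑ) x ≠ ∞) :
    convOp (dilateC φ t) (diffTransform (approxId φ) a v N₁ N₂ f) x =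
      ∑ i ∈ Finset.Icc N₁ N₂, v i * (convOp (dilateC φ t) (convOp (dilateC φ (a (i + 1))) f) x -
        convOp (dilateC φ t) (convOp (dilateC φ (a i)) f) x) := by
  have hint : ∀ i, Integrable (fun y => dilateC φ t (x - y) * convOp (dilateC φ (a i)) f y)
      volume := fun i =>
    integrable_kernel_mul (continuous_dilateC φ _) (dilateC_bound φ ht)
      (aestronglyMeasurable_convOp (continuous_dilateC φ _) hf) (hx i) x
  rw [convOp]
  simp only [diffTransform, Finset.mul_sum, approxId_eq_convOp]
  rw [integral_finsetSum]
  · refine Finset.sum_congr rfl fun i _ => ?_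
    rw [convOp, convOp, ← integral_sub (hint _) (hint _), ← integral_const_mul]
    refine integral_congr_ae (.of_forall fun y => ?_)
    simp only
    ring
  · intro i _
    have := ((hint (i + 1)).sub (hint i)).const_mul (v i)
    refine this.congr (.of_forall fun y => ?_)
    simp only [Pi.sub_apply]
    ring

/-- Cotlar's inequality for one-sided partial sums. -/
theorem exists_cotlar [Nonempty (Fin n)] (φ : 𝓢(EuclideanSpace ℝ (Fin n), ℝ))
    (hφ : ∫ x, φ x = 1) {δ : ℝ} (hδ : 1 < δ) {M : ℝ} (hM : 0 ≤ M) :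
    ∃ C : ℝ≥0, ∀ a : ℤ → ℝ, IsLacunary δ a → ∀ v : ℤ → ℂ, (∀ i, ‖v i‖ ≤ M) →
      ∀ f : EuclideanSpace ℝ (Fin n) → ℂ, AEStronglyMeasurable f volume →
      ∀ x, maximalFn (fun y => ‖f y‖ₑ) x ≠ ∞ →
      maximalFn (maximalFn fun y => ‖f y‖ₑ) x ≠ ∞ →
      ∀ L₁ N L₂ : ℤ, L₁ ≤ N → N ≤ L₂ →
        ‖diffTransform (approxId φ) a v N L₂ f x‖ₑ ≤
          C * maximalFn (fun y => ‖diffTransform (approxId φ) a v L₁ L₂ f y‖ₑ) x +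
          C * maximalFn (fun y => ‖f y‖ₑ) x := by
  obtain ⟨C₁, hC₁⟩ := exists_almost_orthogonality φ hφ
  obtain ⟨B, hB⟩ := exists_dilateC_le φ
  obtain ⟨C₂, hC₂⟩ := exists_enorm_convOp_le (EuclideanSpace ℝ (Fin n))
  have hκ : 0 < δ / (δ - 1) := div_pos (by linarith) (by linarith)
  obtain ⟨c, hc⟩ : ∃ c : ℝ≥0, (c : ℝ) = 2 * (M * (2 * C₁ * (2 * (δ / (δ - 1))))) :=
    ⟨⟨_, by positivity⟩, rfl⟩
  refine ⟨B * C₂ + c, fun a ha v hv f hf x hx hxx L₁ N L₂ hL₁ hL₂ => ?_⟩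
  set m := (maximalFn (fun y => ‖f y‖ₑ) x).toReal with hm
  set P : ℤ → EuclideanSpace ℝ (Fin n) → ℂ := fun i => convOp (dilateC φ (a i)) f with hP
  have hPM : ∀ i, maximalFn (fun y => ‖P i y‖ₑ) x ≠ ∞ := fun i => by
    refine ne_of_lt ?_
    calc maximalFn (fun y => ‖P i y‖ₑ) x
        ≤ maximalFn (fun y => ((B * C₂ : ℝ≥0) : ℝ≥0∞) * maximalFn (fun y => ‖f y‖ₑ) y) x := by
          refine maximalFn_mono (fun y => ?_) x
          push_cast
          exact hC₂ (a i) B _ f (ha.pos i) hf (hB _ (ha.pos i)) y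
      _ ≤ _ := maximalFn_const_mul_le _ _ _
      _ < ∞ := by finiteness
  set Q : ℤ → ℂ := fun i => convOp (dilateC φ (a N)) (P i) x with hQ
  have hmono := (ha.strictMono hδ).monotone
  set b : ℤ → ℝ := fun i => min (a i / a N) (a N / a i) with hb
  have hb0 : ∀ i, 0 ≤ b i := fun i =>
    le_min (div_nonneg (ha.pos _).le (ha.pos _).le) (div_nonneg (ha.pos _).le (ha.pos _).le)
  have hm0 : 0 ≤ m := ENNReal.toReal_nonneg
  -- Averaging at the finer scale `a N` hardly changes `P i`.
  have hup : ∀ i, N ≤ i → ‖Q i - P i x‖ ≤ C₁ * m * b i := fun i hi => by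
    have h1 := hC₁ (a N) (a i) (ha.pos N) (hmono hi) f hf x hx (hPM i)
    refine h1.trans_eq ?_
    congr 1
    have h2 : a N / a i ≤ 1 := (div_le_one (ha.pos i)).2 (hmono hi)
    have h3 : 1 ≤ a i / a N := (one_le_div (ha.pos N)).2 (hmono hi)
    exact (min_eq_right (h2.trans h3)).symm
  -- By commutation the finer average acts on `P N`, so `Q i` is close to a value independent of
  -- `i`.
  have hdown : ∀ i, i ≤ N → ‖Q i - P N x‖ ≤ C₁ * m * b i := fun i hi => by
    have h1 := hC₁ (a i) (a N) (ha.pos i) (hmono hi) f hf x hx (hPM N)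
    have h4 : Q i = convOp (dilateC φ (a i)) (convOp (dilateC φ (a N)) f) x :=
      convOp_comm (continuous_dilateC φ _) (continuous_dilateC φ _) (dilateC_bound φ (ha.pos N))
        (dilateC_bound φ (ha.pos i)) hf hxx
    rw [h4]
    refine h1.trans_eq ?_
    congr 1
    have h2 : a i / a N ≤ 1 := (div_le_one (ha.pos N)).2 (hmono hi)
    have h3 : 1 ≤ a N / a i := (one_le_div (ha.pos i)).2 (hmono hi)
    exact (min_eq_left (h2.trans h3)).symm
  -- Extension by `0` lets the summation lemma, which asks for a bound at all `i`, be applied. Both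
  -- indices `i` and `i + 1` stay in the active branch in the sums below.
  set w : ℤ → ℂ := fun i => if N ≤ i then Q i - P i x else 0 with hw
  set w' : ℤ → ℂ := fun i => if i ≤ N then Q i - P N x else 0 with hw'
  have hwb : ∀ i, ‖w i‖ ≤ C₁ * m * b i := fun i => by
    simp only [hw]
    split_ifs with h
    · exact hup i h
    · rw [norm_zero]; exact mul_nonneg (by positivity) (hb0 i)
  have hwb' : ∀ i, ‖w' i‖ ≤ C₁ * m * b i := fun i => by
    simp only [hw']
    split_ifs with h
    · exact hdown i h
    · rw [norm_zero]; exact mul_nonneg (by positivity) (hb0 i)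
  have hbound : ∀ (w : ℤ → ℂ), (∀ i, ‖w i‖ ≤ C₁ * m * b i) → ∀ N₁ N₂ : ℤ,
      ‖∑ i ∈ Finset.Icc N₁ N₂, v i * (w (i + 1) - w i)‖ ≤
        M * (2 * (C₁ * m) * (2 * (δ / (δ - 1)))) := fun w hw N₁ N₂ => by
    calc _ ≤ ∑ i ∈ Finset.Icc N₁ N₂, M * ‖w (i + 1) - w i‖ := by
          refine norm_sum_le_of_le _ fun i _ => ?_
          rw [norm_mul]
          gcongr
          exact hv i
      _ ≤ _ := by
          rw [← Finset.mul_sum]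
          gcongr
          exact sum_norm_sub_le w b _ _ hw (ha.sum_min_le hδ (ha.pos N) _ _)
            (ha.shift.sum_min_le hδ (ha.pos N) _ _) (by positivity)
  have hsplit : convOp (dilateC φ (a N)) (diffTransform (approxId φ) a v L₁ L₂ f) x =
      ∑ i ∈ Finset.Icc L₁ (N - 1), v i * (Q (i + 1) - Q i) +
        ∑ i ∈ Finset.Icc N L₂, v i * (Q (i + 1) - Q i) := by
    rw [convOp_diffTransform φ a (ha.pos N) v L₁ L₂ hf hPM, ← Finset.sum_union]
    · refine Finset.sum_congr ?_ fun _ _ => rfl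
      ext i
      simp only [Finset.mem_union, Finset.mem_Icc]
      omega
    · rw [Finset.disjoint_left]
      intro i
      simp only [Finset.mem_Icc]
      omega
  have e1 : ∑ i ∈ Finset.Icc L₁ (N - 1), v i * (Q (i + 1) - Q i) =
      ∑ i ∈ Finset.Icc L₁ (N - 1), v i * (w' (i + 1) - w' i) := by
    refine Finset.sum_congr rfl fun i hi => ?_
    rw [Finset.mem_Icc] at hi
    simp only [hw']
    rw [if_pos (by omega), if_pos (by omega), sub_sub_sub_cancel_right]
  have e2 : ∑ i ∈ Finset.Icc N L₂, v i * (Q (i + 1) - Q i) =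
      ∑ i ∈ Finset.Icc N L₂, v i * (w (i + 1) - w i) +
        diffTransform (approxId φ) a v N L₂ f x := by
    rw [diffTransform, ← Finset.sum_add_distrib]
    refine Finset.sum_congr rfl fun i hi => ?_
    rw [Finset.mem_Icc] at hi
    simp only [hw, approxId_eq_convOp]
    rw [if_pos (by omega), if_pos (by omega)]
    simp only [hP]
    ring
  have hreal : ‖diffTransform (approxId φ) a v N L₂ f x‖ ≤
      ‖convOp (dilateC φ (a N)) (diffTransform (approxId φ) a v L₁ L₂ f) x‖ + c * m := by
    have e3 : diffTransform (approxId φ) a v N L₂ f x =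
        convOp (dilateC φ (a N)) (diffTransform (approxId φ) a v L₁ L₂ f) x -
          ∑ i ∈ Finset.Icc L₁ (N - 1), v i * (w' (i + 1) - w' i) -
          ∑ i ∈ Finset.Icc N L₂, v i * (w (i + 1) - w i) := by
      rw [hsplit, e1, e2]; ring
    rw [e3]
    refine (norm_sub_le _ _).trans ((add_le_add (norm_sub_le _ _) (hbound w hwb _ _)).trans ?_)
    have := hbound w' hwb' L₁ (N - 1)
    rw [hc]
    linarith
  have hTm : AEStronglyMeasurable (diffTransform (approxId φ) a v L₁ L₂ f) volume := by
    rw [diffTransform_eq_convOp φ ha.pos v L₁ L₂ hf hx, diffKernel_eq_schwartz φ ha.pos]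
    exact aestronglyMeasurable_convOp (SchwartzMap.continuous _) hf
  calc ‖diffTransform (approxId φ) a v N L₂ f x‖ₑ
      ≤ ‖convOp (dilateC φ (a N)) (diffTransform (approxId φ) a v L₁ L₂ f) x‖ₑ +
        c * maximalFn (fun y => ‖f y‖ₑ) x := by
        rw [← ofReal_norm, ← ofReal_norm, ← ENNReal.ofReal_toReal hx, ← ENNReal.ofReal_coe_nnreal,
          ← ENNReal.ofReal_mul (by positivity),
          ← ENNReal.ofReal_add (norm_nonneg _) (by positivity)]
        exact ENNReal.ofReal_le_ofReal hreal
    _ ≤ _ := by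
        refine add_le_add ((hC₂ (a N) B _ _ (ha.pos N) hTm (hB _ (ha.pos N)) x).trans ?_) ?_
        · gcongr
          push_cast
          exact le_self_add
        · gcongr
          exact le_add_self

end Cotlar

/-! ### The maximal bound -/

section Main

open Metric Set Module

variable {n : ℕ}

theorem diffTransform_sub_diffTransform {X : Type*} (T : ℝ → (X → ℂ) → X → ℂ) (a : ℤ → ℝ)
    (v : ℤ → ℂ) {N₁ N₂ L : ℤ} (h₁ : N₁ ≤ N₂) (h₂ : N₂ < L) (f : X → ℂ) (x : X) :
    diffTransform T a v N₁ N₂ f x =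
      diffTransform T a v N₁ L f x - diffTransform T a v (N₂ + 1) L f x := by
  rw [eq_sub_iff_add_eq, diffTransform, diffTransform, diffTransform, ← Finset.sum_union]
  · refine Finset.sum_congr ?_ fun _ _ => rfl
    ext i
    simp only [Finset.mem_union, Finset.mem_Icc]
    omega
  · rw [Finset.disjoint_left]
    intro i
    simp only [Finset.mem_Icc]
    omega

/-- The `L^q` bound for the maximal differential transform. -/
theorem exists_maximalDiffTransform_lp [Nonempty (Fin n)] (φ : 𝓢(EuclideanSpace ℝ (Fin n), ℝ))
    (hφ : ∫ x, φ x = 1) {δ : ℝ} (hδ : 1 < δ) {M : ℝ} (hM : 0 ≤ M) {q : ℝ} (hq : 1 < q) :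
    ∃ C : ℝ≥0, ∀ a : ℤ → ℝ, IsLacunary δ a → ∀ v : ℤ → ℂ, (∀ i, ‖v i‖ ≤ M) →
      ∀ f : EuclideanSpace ℝ (Fin n) → ℂ, AEStronglyMeasurable f volume →
      ∫⁻ x, ‖f x‖ₑ ^ q ≠ ∞ →
      ∫⁻ x, maximalDiffTransform (approxId φ) a v f x ^ q ≤ C * ∫⁻ x, ‖f x‖ₑ ^ q := by
  obtain ⟨A, hA⟩ := exists_isCZKernel_diffKernel φ hφ hδ hM
  obtain ⟨C₁, hC₁⟩ := exists_convOp_lp (EuclideanSpace ℝ (Fin n)) A hq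
  obtain ⟨C₂, hC₂⟩ := exists_cotlar φ hφ hδ hM
  obtain ⟨C₃, hC₃⟩ := strong_type_maximalFn (EuclideanSpace ℝ (Fin n)) hq
  have hq0 : 0 < q := by linarith
  refine ⟨(2 * C₂) ^ q * (2 ^ (q - 1) * (C₃ * C₁ + C₃)), fun a ha v hv f hf hfin => ?_⟩
  set m := maximalFn (fun y => ‖f y‖ₑ) with hm
  have hmm : Measurable m := measurable_maximalFn _
  have hmfin : ∫⁻ x, m x ^ q ≠ ∞ := ((hC₃ _ hf.enorm).trans_lt (by finiteness)).ne
  have hae1 := maximalFn_ae_ne_top hq hf.enorm hfin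
  have hae2 := maximalFn_ae_ne_top hq hmm.aemeasurable hmfin
  obtain ⟨x₀, hx₀⟩ := hae1.exists
  set T : ℕ → EuclideanSpace ℝ (Fin n) → ℂ := fun L =>
    diffTransform (approxId φ) a v (-L) L f with hT
  have hTeq : ∀ L : ℕ, T L = convOp (diffKernel φ a v (-L) L) f := fun L =>
    diffTransform_eq_convOp φ ha.pos v _ _ hf hx₀
  set U : ℕ → EuclideanSpace ℝ (Fin n) → ℝ≥0∞ := fun L x =>
    ((2 * C₂ : ℝ≥0) : ℝ≥0∞) * (maximalFn (fun y => ‖T L y‖ₑ) x + m x) with hU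
  have hUm : ∀ L, Measurable (U L) := fun L =>
    ((measurable_maximalFn _).add hmm).const_mul _
  -- Every fixed pair `N₁ < N₂` lies in `[-L, L]` with `N₂ + 1 ≤ L` for large `L`, where Cotlar
  -- applies twice. The liminf therefore dominates each partial sum, hence the supremum, although `U
  -- L` need not be monotone in `L`.
  have hpt : ∀ᵐ x, maximalDiffTransform (approxId φ) a v f x ^ q ≤
      Filter.liminf (fun L => U L x ^ q) Filter.atTop := by
    filter_upwards [hae1, hae2] with x hx hxx
    rw [← ENNReal.le_rpow_inv_iff hq0, maximalDiffTransform]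
    refine iSup_le fun N₁ => iSup_le fun N₂ => iSup_le fun hN => ?_
    rw [ENNReal.le_rpow_inv_iff hq0]
    refine Filter.le_liminf_of_le (by isBoundedDefault) ?_
    filter_upwards [Filter.eventually_ge_atTop (N₁.natAbs + N₂.natAbs + 1)] with L hL
    gcongr
    have hLN₁ : -(L : ℤ) ≤ N₁ := by omega
    have hLN₂ : N₂ < (L : ℤ) := by omega
    rw [diffTransform_sub_diffTransform (approxId φ) a v hN.le hLN₂]
    have h1 := hC₂ a ha v hv f hf x hx hxx (-L) N₁ L hLN₁ (by omega)
    have h2 := hC₂ a ha v hv f hf x hx hxx (-L) (N₂ + 1) L (by omega) (by omega)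
    refine (enorm_sub_le (E := ℂ)).trans ((add_le_add h1 h2).trans_eq ?_)
    simp only [hU, hT]
    push_cast
    ring
  have hUint : ∀ L, ∫⁻ x, U L x ^ q ≤
      ((2 * C₂) ^ q * (2 ^ (q - 1) * (C₃ * C₁ + C₃)) : ℝ≥0) * ∫⁻ x, ‖f x‖ₑ ^ q := fun L => by
    have hTm : AEStronglyMeasurable (T L) volume := by
      rw [hTeq]
      exact aestronglyMeasurable_convOp (hA a ha v hv _ _).continuous hf
    have h1 : ∫⁻ x, maximalFn (fun y => ‖T L y‖ₑ) x ^ q ≤ C₃ * (C₁ * ∫⁻ x, ‖f x‖ₑ ^ q) := by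
      refine (hC₃ _ hTm.enorm).trans ?_
      gcongr
      rw [hTeq]
      exact hC₁ _ (hA a ha v hv _ _) f hf hfin
    calc ∫⁻ x, U L x ^ q
        ≤ ∫⁻ x, ((2 * C₂ : ℝ≥0) : ℝ≥0∞) ^ q * (2 ^ (q - 1) *
          (maximalFn (fun y => ‖T L y‖ₑ) x ^ q + m x ^ q)) := by
          refine lintegral_mono fun x => ?_
          simp only [hU]
          rw [ENNReal.mul_rpow_of_nonneg _ _ hq0.le]
          gcongr
          exact ENNReal.rpow_add_le_mul_rpow_add_rpow _ _ hq.le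
      _ = ((2 * C₂ : ℝ≥0) : ℝ≥0∞) ^ q * (2 ^ (q - 1) *
          ((∫⁻ x, maximalFn (fun y => ‖T L y‖ₑ) x ^ q) + ∫⁻ x, m x ^ q)) := by
          rw [lintegral_const_mul' _ _ (by finiteness), lintegral_const_mul' _ _ (by
            exact ENNReal.rpow_ne_top_of_nonneg (by linarith) (by simp)),
            lintegral_add_left ((measurable_maximalFn _).pow_const _)]
      _ ≤ ((2 * C₂ : ℝ≥0) : ℝ≥0∞) ^ q * (2 ^ (q - 1) *
          (C₃ * (C₁ * ∫⁻ x, ‖f x‖ₑ ^ q) + C₃ * ∫⁻ x, ‖f x‖ₑ ^ q)) := by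
          gcongr
          exact hC₃ _ hf.enorm
      _ = _ := by
          have h2 : (((2 : ℝ≥0) ^ (q - 1) : ℝ≥0) : ℝ≥0∞) = 2 ^ (q - 1) := by
            rw [ENNReal.coe_rpow_of_nonneg _ (by linarith)]; rfl
          simp only [ENNReal.coe_mul, ENNReal.coe_add, h2, ENNReal.coe_rpow_of_nonneg _ hq0.le]
          ring
  calc ∫⁻ x, maximalDiffTransform (approxId φ) a v f x ^ q
      ≤ ∫⁻ x, Filter.liminf (fun L => U L x ^ q) Filter.atTop := lintegral_mono_ae hpt
    _ ≤ Filter.liminf (fun L => ∫⁻ x, U L x ^ q) Filter.atTop :=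
        lintegral_liminf_le fun L => (hUm L).pow_const q
    _ ≤ _ := by
        refine (Filter.liminf_le_liminf (.of_forall hUint)).trans_eq ?_
        exact Filter.liminf_const _

theorem aemeasurable_maximalDiffTransform (φ : 𝓢(EuclideanSpace ℝ (Fin n), ℝ)) (a : ℤ → ℝ)
    (v : ℤ → ℂ) {f : EuclideanSpace ℝ (Fin n) → ℂ} (hf : AEStronglyMeasurable f volume) :
    AEMeasurable (maximalDiffTransform (approxId φ) a v f) volume := by
  refine AEMeasurable.iSup fun N₁ => AEMeasurable.iSup fun N₂ => AEMeasurable.iSup fun _ => ?_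
  refine AEStronglyMeasurable.enorm ?_
  have h : ∀ i, AEStronglyMeasurable (approxId φ (a i) f) volume := fun i => by
    rw [approxId_eq_convOp]
    exact aestronglyMeasurable_convOp (continuous_dilateC φ _) hf
  unfold diffTransform
  exact Finset.aestronglyMeasurable_fun_sum _ fun i _ => ((h (i + 1)).sub (h i)).const_mul (v i)

theorem convolutionExists_dilate [Nonempty (Fin n)] (φ : 𝓢(EuclideanSpace ℝ (Fin n), ℝ)) {t : ℝ}
    (ht : 0 < t) {q : ℝ} (hq : 1 < q) {f : EuclideanSpace ℝ (Fin n) → ℂ}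
    (hf : AEStronglyMeasurable f volume) (hfin : ∫⁻ x, ‖f x‖ₑ ^ q ≠ ∞) :
    ConvolutionExists (dilate φ t) f (ContinuousLinearMap.lsmul ℝ ℝ) volume := by
  intro x
  obtain ⟨x₀, hx₀⟩ := (maximalFn_ae_ne_top hq hf.enorm hfin).exists
  rw [convolutionExistsAt_iff_integrable_swap]
  exact integrable_kernel_mul (continuous_dilateC φ t) (dilateC_bound φ ht) hf hx₀ x

end Main

theorem mainTheorem4 (n : ℕ) (φ : 𝓢(EuclideanSpace ℝ (Fin n), ℝ)) (hφ : ∫ x, φ x = 1)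
    (p : ℝ≥0∞) (hp₁ : 1 < p) (hp : p < ∞) (δ : ℝ) (hδ : 1 < δ) (M : ℝ) :
    ∃ C : ℝ≥0, 0 < C ∧
      ∀ a : ℤ → ℝ, IsLacunary δ a →
      ∀ v : ℤ → ℂ, (∀ i, ‖v i‖ ≤ M) →
      ∀ f : EuclideanSpace ℝ (Fin n) → ℂ, MemLp f p volume →
        (∀ t : ℝ, 0 < t →
          ConvolutionExists (dilate φ t) f (ContinuousLinearMap.lsmul ℝ ℝ) volume) ∧
        AEMeasurable (maximalDiffTransform (approxId φ) a v f) volume ∧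
        eLpNorm (maximalDiffTransform (approxId φ) a v f) p volume ≤ C * eLpNorm f p volume := by
  have hp0 : p ≠ 0 := (zero_lt_one.trans hp₁).ne'
  have hq : 1 < p.toReal := by
    rw [← ENNReal.toReal_one]
    exact (ENNReal.toReal_lt_toReal ENNReal.one_ne_top hp.ne).2 hp₁
  rcases isEmpty_or_nonempty (Fin n) with hn | hn
  -- In dimension `0` all dilates coincide, so every difference vanishes.
  · refine ⟨1, one_pos, fun a _ v _ f hf => ⟨fun t _ x => ?_,
      aemeasurable_maximalDiffTransform φ a v hf.1, ?_⟩⟩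
    · have : IsFiniteMeasure (volume : Measure (EuclideanSpace ℝ (Fin n))) :=
        CompactSpace.isFiniteMeasure
      exact Integrable.of_finite
    · have hd : ∀ t, approxId φ t f = approxId φ 1 f := fun t => by
        have hn0 : n = 0 := by
          by_contra h0
          exact hn.false ⟨0, Nat.pos_of_ne_zero h0⟩
        have : dilate φ t = dilate φ 1 := by
          have hpow : ∀ s : ℝ, s ^ n = 1 := fun s => by rw [hn0, pow_zero]
          ext x
          rw [dilate, dilate, Subsingleton.elim (t⁻¹ • x) ((1 : ℝ)⁻¹ • x), hpow, hpow]
        rw [approxId, approxId, this]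
      have h0 : maximalDiffTransform (approxId φ) a v f = fun _ => 0 := by
        ext x
        simp [maximalDiffTransform, diffTransform, fun t => congrFun (hd t) x]
      rw [h0]
      simp
  -- The sign of `M` is not assumed here, so `|M|` is used.
  · obtain ⟨C, hC⟩ := exists_maximalDiffTransform_lp φ hφ hδ (abs_nonneg M) hq
    refine ⟨C ^ (1 / p.toReal) + 1, by positivity, fun a ha v hv f hf => ?_⟩
    have hfin : ∫⁻ x, ‖f x‖ₑ ^ p.toReal ≠ ∞ := by
      rw [lintegral_rpow_enorm_eq hp0 hp.ne]
      exact ENNReal.rpow_ne_top_of_nonneg ENNReal.toReal_nonneg hf.2.ne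
    refine ⟨fun t ht => convolutionExists_dilate φ ht hq hf.1 hfin,
      aemeasurable_maximalDiffTransform φ a v hf.1, ?_⟩
    have h1 := hC a ha v (fun i => (hv i).trans (le_abs_self M)) f hf.1 hfin
    have hq0 : 0 ≤ 1 / p.toReal := by positivity
    rw [eLpNorm_eq_lintegral_rpow_enorm_toReal hp0 hp.ne,
      eLpNorm_eq_lintegral_rpow_enorm_toReal hp0 hp.ne]
    simp only [enorm_eq_self]
    calc _ ≤ (C * ∫⁻ x, ‖f x‖ₑ ^ p.toReal) ^ (1 / p.toReal) := by gcongr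
      _ = ((C ^ (1 / p.toReal) : ℝ≥0) : ℝ≥0∞) *
          (∫⁻ x, ‖f x‖ₑ ^ p.toReal) ^ (1 / p.toReal) := by
          rw [ENNReal.mul_rpow_of_nonneg _ _ hq0, ENNReal.coe_rpow_of_nonneg _ hq0]
      _ ≤ _ := by
          gcongr
          exact le_self_add
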